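/- Call a function $f:\mathbb R^n\to\mathbb R$ entire if it extends to a holomorphic function on $\mathbb C^n$. For $\lambda\in\mathbb R\setminus\{0\}$, a Beltrami field on $\mathbb R^3$ with constant $\lambda$ is a $C^1$ vector field $u:\mathbb R^3\to\mathbb R^3$ satisfying $\operatorname{curl}u=\lambda u$ at every point of $\mathbb R^3$. **Theorem 3.1.** Let $F:\mathbb R^2\to\mathbb R$ be entire. Then for every real $\lambda\neq 0$ there is a unique Beltrami field $u$ on all of $\mathbb R^3$ with constant $\lambda$ that solves the Cauchy problem $$\operatorname{curl}u=\lambda u \ \text{ in } \mathbb R^3,\qquad u(x,y,0)=\Big(\frac{\partial F}{\partial x}(x,y),\,\frac{\partial F}{\partial y}(x,y),\,0\Big)\ \text{ for all } (x,y)\in\mathbb R^2 .$$ Moreover, each of the three components of $u$ is entire. -/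

import Mathlib

open scoped Gradient

/-- A real function on `ℝⁿ` is entire if it extends to a holomorphic function on `ℂⁿ`. -/
def IsEntire {n : ℕ} (f : EuclideanSpace ℝ (Fin n) → ℝ) : Prop :=
  ∃ G : (Fin n → ℂ) → ℂ, Differentiable ℂ G ∧
    ∀ p : EuclideanSpace ℝ (Fin n), G (fun i => (p i : ℂ)) = (f p : ℂ)

/-- The partial derivative `∂ᵢ uⱼ` at `p` of a vector field `u` on `ℝ³`. -/
noncomputable def pderivComp
    (u : EuclideanSpace ℝ (Fin 3) → EuclideanSpace ℝ (Fin 3))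
    (i j : Fin 3) (p : EuclideanSpace ℝ (Fin 3)) : ℝ :=
  fderiv ℝ u p (EuclideanSpace.single i 1) j

/-- The curl of a vector field on Euclidean `ℝ³`. -/
noncomputable def curl
    (u : EuclideanSpace ℝ (Fin 3) → EuclideanSpace ℝ (Fin 3))
    (p : EuclideanSpace ℝ (Fin 3)) : EuclideanSpace ℝ (Fin 3) :=
  !₂[pderivComp u 1 2 p - pderivComp u 2 1 p,
     pderivComp u 2 0 p - pderivComp u 0 2 p,
     pderivComp u 0 1 p - pderivComp u 1 0 p]

/-- A Beltrami field on `ℝ³` with constant `lam ≠ 0`: a vector field of class `C¹` with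
`curl u = lam u` at every point. -/
structure IsBeltramiField (lam : ℝ)
    (u : EuclideanSpace ℝ (Fin 3) → EuclideanSpace ℝ (Fin 3)) : Prop where
  ne_zero : lam ≠ 0
  contDiff : ContDiff ℝ 1 u
  curl_eq : ∀ p, curl u p = lam • u p

/-- `u|_{z = 0} = ∇F`, the planar gradient being regarded as a vector field along the plane
`{z = 0}` that is tangent to it. -/
def HasGradientDatum (F : EuclideanSpace ℝ (Fin 2) → ℝ)
    (u : EuclideanSpace ℝ (Fin 3) → EuclideanSpace ℝ (Fin 3)) : Prop :=
  ∀ x y : ℝ, u !₂[x, y, 0] = !₂[(∇ F !₂[x, y]) 0, (∇ F !₂[x, y]) 1, 0]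

/-!
Existence. The Beltrami field is sought in the form `u = curl curl (W e₂) + lam curl (W e₂)`, with
`e₂` the vertical direction. For this `u` the equation `curl u = lam u` follows from the Helmholtz
equation `ΔW + lam² W = 0` (`isBeltramiField_potentialField`), and `u = ∇F` on the plane `z = 0`
follows from `W = 0`, `∂_z W = F` there. With `A = ∂_x² + ∂_y² + lam²` this Cauchy problem for `W` is
solved by `W = ∑ (-1)ᵏ z²ᵏ⁺¹ / (2k+1)! Aᵏ F`. Applying Cauchy's estimate `2k` times to the entire
extension of `F`, each time with the radius enlarged by a multiple of `1/k`, bounds `Aᵏ F` on a ball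
of radius `r` by `(8 k² / ρ² + lam²)ᵏ` times the supremum of `F` on the ball of radius `r + ρ`.
Against `(2k+1)!`, and with `ρ` a large multiple of `r`, this makes the series converge on all of
`ℂ³` (`locallySummable_waveTerm`). Hence `W` is entire, and so is `u`
(`exists_entire_beltramiField`).

Uniqueness. The difference `v` of two solutions is a Beltrami field of class `C¹` that vanishes on
the plane. Cut off to a half space and extended by zero, it is still a continuous weak solution of
`curl v = lam v`, so its components are weak solutions of `Δf + lam² f = 0`
(`integral_halfSpace_helmholtz`) that vanish on the opposite half space. Instead of proving and using
analyticity of weak solutions, unique continuation is derived from spherical means. If `f` vanishes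
near `x`, then solving the radial Helmholtz equation by variation of constants shows that `f` is
orthogonal to every compactly supported radial function centred at `x`
(`exists_radial_solution`). The functions that have this property for all `x` in an open set are
stable under multiplication by the coordinates, as one sees by differentiating in `x`
(`RadialMomentsVanish.coord_mul`). So `f` times any polynomial has the property, and `f = 0` by the
Stone–Weierstrass theorem (`RadialMomentsVanish.eq_zero`).
-/

open MeasureTheory Metric Set Filter Topology
open scoped ContDiff Convolution

/-! ### Directional derivatives -/

/-- The derivative of a scalar function `g` in the direction `v`, as a function of the point. It is
used over `ℝ` and over `ℂ`; the scalar field is read off from the codomain of `g`. -/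
noncomputable def dirDeriv {𝕜 E : Type*} [RCLike 𝕜] [NormedAddCommGroup E] [NormedSpace 𝕜 E]
    (v : E) (g : E → 𝕜) : E → 𝕜 :=
  fun p => fderiv 𝕜 g p v

section DirDeriv

variable {𝕜 E : Type*} [RCLike 𝕜] [NormedAddCommGroup E] [NormedSpace 𝕜 E]

theorem dirDeriv_eq {g : E → 𝕜} {g' : E →L[𝕜] 𝕜} {p : E} (h : HasFDerivAt g g' p) (v : E) :
    dirDeriv v g p = g' v := by
  rw [dirDeriv, h.fderiv]

@[simp]
theorem dirDeriv_zero (v : E) : dirDeriv v (0 : E → 𝕜) = 0 := by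
  funext p
  simp [dirDeriv]

theorem dirDeriv_add {f g : E → 𝕜} (hf : Differentiable 𝕜 f) (hg : Differentiable 𝕜 g) (v : E) :
    dirDeriv v (fun p => f p + g p) = fun p => dirDeriv v f p + dirDeriv v g p :=
  funext fun p => dirDeriv_eq ((hf p).hasFDerivAt.add (hg p).hasFDerivAt) v

theorem dirDeriv_neg (f : E → 𝕜) (v : E) :
    dirDeriv v (fun p => -f p) = fun p => -dirDeriv v f p := by
  funext p
  simp [dirDeriv, fderiv_fun_neg]

theorem dirDeriv_const_mul {f : E → 𝕜} (hf : Differentiable 𝕜 f) (c : 𝕜) (v : E) :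
    dirDeriv v (fun p => c * f p) = fun p => c * dirDeriv v f p :=
  funext fun p => dirDeriv_eq ((hf p).hasFDerivAt.const_mul c) v

theorem dirDeriv_mul {f g : E → 𝕜} {p : E} (hf : DifferentiableAt 𝕜 f p)
    (hg : DifferentiableAt 𝕜 g p) (v : E) :
    dirDeriv v (fun p => f p * g p) p = f p * dirDeriv v g p + dirDeriv v f p * g p := by
  have h : HasFDerivAt (fun p => f p * g p) _ p := hf.hasFDerivAt.mul hg.hasFDerivAt
  rw [dirDeriv_eq h v]
  simp [dirDeriv, mul_comm]

/-- Directional derivatives of a `C²` function commute. -/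
theorem dirDeriv_comm {g : E → 𝕜} (hg : ContDiff 𝕜 2 g) (v w : E) :
    dirDeriv v (dirDeriv w g) = dirDeriv w (dirDeriv v g) := by
  funext p
  have hd : DifferentiableAt 𝕜 (fderiv 𝕜 g) p :=
    ((hg.fderiv_right (m := 1) (by norm_num)).differentiable (by norm_num)) p
  have hs : IsSymmSndFDerivAt 𝕜 g p :=
    hg.contDiffAt.isSymmSndFDerivAt (by simp)
  have key : ∀ a : E, HasFDerivAt (dirDeriv a g)
      ((fderiv 𝕜 (fderiv 𝕜 g) p).flip a) p := by
    intro a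
    exact (hd.hasFDerivAt.clm_apply (hasFDerivAt_const a p)).congr_fderiv (by ext; simp)
  rw [dirDeriv_eq (key w), dirDeriv_eq (key v)]
  exact hs.eq v w

theorem contDiff_dirDeriv {g : E → 𝕜} {m n : WithTop ℕ∞} (hg : ContDiff 𝕜 n g) (hmn : m + 1 ≤ n)
    (v : E) : ContDiff 𝕜 m (dirDeriv v g) :=
  (hg.fderiv_right hmn).clm_apply contDiff_const

/-- A derivative tangent to a set of points on which two functions agree is the same for both. -/
theorem dirDeriv_eq_of_eq_on_line {f g : E → 𝕜} {p v : E} (hf : DifferentiableAt 𝕜 f p)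
    (hg : DifferentiableAt 𝕜 g p) (h : ∀ t : 𝕜, f (p + t • v) = g (p + t • v)) :
    dirDeriv v f p = dirDeriv v g p := by
  have := congrArg (fun k => deriv k 0) (funext h)
  have e : ∀ {k : E → 𝕜}, DifferentiableAt 𝕜 k p →
      deriv (fun t : 𝕜 => k (p + t • v)) 0 = dirDeriv v k p := by
    intro k hk
    have := hk.lineDeriv_eq_fderiv (v := v)
    simpa [lineDeriv, dirDeriv] using this
  rwa [e hf, e hg] at this

end DirDeriv

/-! ### Cauchy estimates in several complex variables -/

section CauchyEstimates

variable {n : ℕ}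

theorem norm_dirDeriv_le {G : (Fin n → ℂ) → ℂ} (hG : Differentiable ℂ G) {p : Fin n → ℂ}
    {δ M : ℝ} (hδ : 0 < δ) (hM : ∀ q ∈ closedBall p δ, ‖G q‖ ≤ M) (v : Fin n → ℂ) :
    ‖dirDeriv v G p‖ ≤ M / δ * ‖v‖ := by
  rcases eq_or_ne v 0 with rfl | hv
  · simp [dirDeriv]
  have hv' : 0 < ‖v‖ := norm_pos_iff.2 hv
  have hd : Differentiable ℂ (fun t : ℂ => G (p + t • v)) := by fun_prop
  have e : dirDeriv v G p = deriv (fun t : ℂ => G (p + t • v)) 0 := by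
    have := (hG p).lineDeriv_eq_fderiv (v := v)
    simpa [lineDeriv, dirDeriv] using this.symm
  rw [e]
  have := Complex.norm_deriv_le_of_forall_mem_sphere_norm_le (c := 0) (R := δ / ‖v‖) (C := M)
    (f := fun t : ℂ => G (p + t • v)) (by positivity) hd.diffContOnCl (by
      intro z hz
      apply hM
      rw [mem_sphere_zero_iff_norm] at hz
      simp [dist_eq_norm, norm_smul, hz, hv'.ne'])
  calc _ ≤ _ := this
    _ = _ := by field_simp

theorem norm_fderiv_le {G : (Fin n → ℂ) → ℂ} (hG : Differentiable ℂ G) {p : Fin n → ℂ}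
    {δ M : ℝ} (hδ : 0 < δ) (hM : ∀ q ∈ closedBall p δ, ‖G q‖ ≤ M) :
    ‖fderiv ℂ G p‖ ≤ M / δ := by
  have hM0 : 0 ≤ M := (norm_nonneg _).trans (hM p (mem_closedBall_self hδ.le))
  exact ContinuousLinearMap.opNorm_le_bound _ (by positivity) fun v => norm_dirDeriv_le hG hδ hM v

theorem exists_bound_closedBall {G : (Fin n → ℂ) → ℂ} (hG : Differentiable ℂ G) (r : ℝ) :
    ∃ M, 0 ≤ M ∧ ∀ q ∈ closedBall (0 : Fin n → ℂ) r, ‖G q‖ ≤ M := by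
  obtain ⟨M, hM⟩ := (isCompact_closedBall (0 : Fin n → ℂ) r).exists_bound_of_continuousOn
    hG.continuous.continuousOn
  exact ⟨max M 0, le_max_right _ _, fun q hq => (hM q hq).trans (le_max_left _ _)⟩

/-- Cauchy's integral formula for a directional derivative, over the unit circle. -/
theorem dirDeriv_eq_integral {G : (Fin n → ℂ) → ℂ} (hG : Differentiable ℂ G) (v p : Fin n → ℂ) :
    dirDeriv v G p = (2 * Real.pi * Complex.I)⁻¹ *
      ∫ θ in (0 : ℝ)..2 * Real.pi, deriv (circleMap 0 1) θ * ((1 / (circleMap 0 1 θ) ^ 2) *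
        G (p + circleMap 0 1 θ • v)) := by
  have hd : Differentiable ℂ (fun t : ℂ => G (p + t • v)) := by fun_prop
  have e : dirDeriv v G p = deriv (fun t : ℂ => G (p + t • v)) 0 := by
    have := (hG p).lineDeriv_eq_fderiv (v := v)
    simpa [lineDeriv, dirDeriv] using this.symm
  have := hd.differentiableOn.deriv_eq_smul_circleIntegral (c := 0) (R := 1) (by norm_num)
    (f := fun t : ℂ => G (p + t • v))
  rw [e]
  simp only [circleIntegral, smul_eq_mul, sub_zero] at this
  rw [this, inv_mul_cancel_left₀]
  simp [Real.pi_ne_zero]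

/-- The partial derivatives of an entire function of several variables are entire. -/
theorem differentiable_dirDeriv {G : (Fin n → ℂ) → ℂ} (hG : Differentiable ℂ G) (v : Fin n → ℂ) :
    Differentiable ℂ (dirDeriv v G) := by
  rw [show dirDeriv v G = _ from funext (dirDeriv_eq_integral hG v)]
  refine Differentiable.const_mul (fun p => ?_) _
  obtain ⟨M, hM0, hM⟩ := exists_bound_closedBall hG (‖p‖ + 1 + ‖v‖ + 1)
  have hker : Continuous fun θ : ℝ => deriv (circleMap 0 1) θ * (1 / (circleMap 0 1 θ) ^ 2) := by
    simp only [deriv_circleMap]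
    refine ((continuous_circleMap 0 1).mul continuous_const).mul ?_
    exact continuous_const.div ((continuous_circleMap 0 1).pow 2) fun θ => by simp [circleMap]
  have hcont : ∀ q, Continuous fun θ : ℝ => deriv (circleMap 0 1) θ *
      ((1 / (circleMap 0 1 θ) ^ 2) * G (q + circleMap 0 1 θ • v)) := by
    intro q
    have h1 : Continuous (fun θ : ℝ => G (q + circleMap 0 1 θ • v)) :=
      hG.continuous.comp (by fun_prop)
    exact (hker.mul h1).congr fun θ => mul_assoc _ _ _
  have hmeas : StronglyMeasurable (fun θ : ℝ =>
      (deriv (circleMap 0 1) θ * (1 / (circleMap 0 1 θ) ^ 2)) •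
        fderiv ℂ G (p + circleMap 0 1 θ • v)) := by
    have h1 : Measurable fun θ : ℝ => fderiv ℂ G (p + circleMap 0 1 θ • v) :=
      (measurable_fderiv ℂ G).comp (Continuous.measurable (by fun_prop))
    exact hker.stronglyMeasurable.smul h1.stronglyMeasurable
  refine (intervalIntegral.hasFDerivAt_integral_of_dominated_of_fderiv_le
    (F' := fun q θ => (deriv (circleMap 0 1) θ * (1 / (circleMap 0 1 θ) ^ 2)) •
      fderiv ℂ G (q + circleMap 0 1 θ • v)) (bound := fun _ => M)
    (ball_mem_nhds p one_pos) (Eventually.of_forall fun q => (hcont q).aestronglyMeasurable)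
    ((hcont p).intervalIntegrable _ _) hmeas.aestronglyMeasurable ?_ (by simp) ?_).differentiableAt
  · refine Eventually.of_forall fun θ _ q hq => ?_
    have h1 : ‖fderiv ℂ G (q + circleMap 0 1 θ • v)‖ ≤ M / 1 := by
      refine norm_fderiv_le hG one_pos fun x hx => hM x ?_
      rw [mem_closedBall_zero_iff]
      rw [mem_closedBall_iff_norm] at hx
      rw [mem_ball_iff_norm] at hq
      have a1 : ‖circleMap 0 1 θ • v‖ = ‖v‖ := by simp [norm_smul]
      calc ‖x‖ = ‖(x - (q + circleMap 0 1 θ • v)) + (q - p) + p + circleMap 0 1 θ • v‖ := by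
            congr 1; abel
        _ ≤ 1 + 1 + ‖p‖ + ‖v‖ := by
            refine (norm_add_le _ _).trans (add_le_add ((norm_add_le _ _).trans
              (add_le_add ((norm_add_le _ _).trans (add_le_add hx hq.le)) le_rfl)) a1.le)
        _ = _ := by ring
    rw [norm_smul]
    simpa [deriv_circleMap] using h1
  · refine Eventually.of_forall fun θ _ q _ => ?_
    have h1 : HasFDerivAt (fun q => G (q + circleMap 0 1 θ • v))
        (fderiv ℂ G (q + circleMap 0 1 θ • v)) q := by
      have := (hG (q + circleMap 0 1 θ • v)).hasFDerivAt.comp q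
        ((hasFDerivAt_id q).add_const (circleMap 0 1 θ • v))
      exact this
    have h2 := h1.const_mul (deriv (circleMap 0 1) θ * (1 / (circleMap 0 1 θ) ^ 2))
    refine h2.congr_of_eventuallyEq (Eventually.of_forall fun x => ?_)
    simp only [mul_assoc]

/-- An entire function of several variables is continuously differentiable to any order. -/
theorem contDiff_of_differentiable {G : (Fin n → ℂ) → ℂ} (hG : Differentiable ℂ G) (m : ℕ) :
    ContDiff ℂ m G := by
  induction m generalizing G with
  | zero => simpa using hG.continuous
  | succ m ih =>
    push_cast
    refine contDiff_succ_iff_fderiv_apply.2 ⟨hG, by simp, fun v => ?_⟩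
    exact ih (differentiable_dirDeriv hG v)

end CauchyEstimates

/-! ### The entire solution of the Cauchy problem for the Helmholtz equation -/

/-- A series of entire functions on `ℂⁿ` that is dominated by a convergent numerical series on
every ball around the origin. -/
structure LocallySummable {n : ℕ} (f : ℕ → (Fin n → ℂ) → ℂ) : Prop where
  differentiable : ∀ k, Differentiable ℂ (f k)
  bound : ∀ r : ℝ, ∃ u : ℕ → ℝ, Summable u ∧
    ∀ k, ∀ p ∈ closedBall (0 : Fin n → ℂ) r, ‖f k p‖ ≤ u k

namespace LocallySummable

variable {n : ℕ} {f : ℕ → (Fin n → ℂ) → ℂ}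

theorem summable (hf : LocallySummable f) (p : Fin n → ℂ) : Summable fun k => f k p := by
  obtain ⟨u, hu, h⟩ := hf.bound ‖p‖
  exact Summable.of_norm_bounded hu fun k => h k p (by simp)

theorem exists_bound_fderiv (hf : LocallySummable f) (r : ℝ) :
    ∃ u : ℕ → ℝ, Summable u ∧
      ∀ k, ∀ p ∈ closedBall (0 : Fin n → ℂ) r, ‖fderiv ℂ (f k) p‖ ≤ u k := by
  obtain ⟨u, hu, h⟩ := hf.bound (r + 1)
  refine ⟨u, hu, fun k p hp => ?_⟩
  simpa using norm_fderiv_le (hf.differentiable k) one_pos (M := u k) fun q hq => h k q (by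
    rw [mem_closedBall_zero_iff] at *
    rw [mem_closedBall_iff_norm] at hq
    calc ‖q‖ = ‖p + (q - p)‖ := by congr 1; abel
      _ ≤ r + 1 := (norm_add_le _ _).trans (add_le_add hp hq))

protected theorem dirDeriv (hf : LocallySummable f) (v : Fin n → ℂ) :
    LocallySummable fun k => dirDeriv v (f k) where
  differentiable k := differentiable_dirDeriv (hf.differentiable k) v
  bound r := by
    obtain ⟨u, hu, h⟩ := hf.exists_bound_fderiv r
    exact ⟨fun k => u k * ‖v‖, hu.mul_right _, fun k p hp =>
      ((fderiv ℂ (f k) p).le_opNorm v).trans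
        (mul_le_mul_of_nonneg_right (h k p hp) (norm_nonneg v))⟩

theorem hasFDerivAt_tsum (hf : LocallySummable f) (p : Fin n → ℂ) :
    HasFDerivAt (fun q => ∑' k, f k q) (∑' k, fderiv ℂ (f k) p) p := by
  obtain ⟨u, hu, h⟩ := hf.exists_bound_fderiv (‖p‖ + 1)
  have hp : p ∈ ball (0 : Fin n → ℂ) (‖p‖ + 1) := by simp
  exact hasFDerivAt_tsum_of_isPreconnected hu isOpen_ball
    (convex_ball (0 : Fin n → ℂ) (‖p‖ + 1)).isPreconnected
    (fun k q _ => (hf.differentiable k q).hasFDerivAt)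
    (fun k q hq => h k q (ball_subset_closedBall hq)) hp (hf.summable p) hp

theorem differentiable_tsum (hf : LocallySummable f) : Differentiable ℂ fun q => ∑' k, f k q :=
  fun p => (hf.hasFDerivAt_tsum p).differentiableAt

theorem dirDeriv_tsum (hf : LocallySummable f) (v : Fin n → ℂ) :
    dirDeriv v (fun q => ∑' k, f k q) = fun q => ∑' k, dirDeriv v (f k) q := by
  funext p
  obtain ⟨u, hu, h⟩ := hf.exists_bound_fderiv ‖p‖
  have hs : Summable fun k => fderiv ℂ (f k) p :=
    Summable.of_norm_bounded hu fun k => h k p (by simp)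
  rw [dirDeriv_eq (hf.hasFDerivAt_tsum p) v]
  exact (ContinuousLinearMap.apply ℂ ℂ v).map_tsum hs

end LocallySummable

/-- The coordinate directions of `ℂ³`. -/
noncomputable abbrev cdir (i : Fin 3) : Fin 3 → ℂ := Pi.single i 1

/-- The operator `∂₀² + ∂₁² + c²` on entire functions on `ℂ³`, with derivatives only in the two
horizontal variables. -/
noncomputable def planarHelmholtz (c : ℂ) (G : (Fin 3 → ℂ) → ℂ) : (Fin 3 → ℂ) → ℂ := fun p =>
  dirDeriv (cdir 0) (dirDeriv (cdir 0) G) p + dirDeriv (cdir 1) (dirDeriv (cdir 1) G) p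
    + c ^ 2 * G p

section PlanarHelmholtz

variable {c : ℂ} {G : (Fin 3 → ℂ) → ℂ}

theorem differentiable_planarHelmholtz (hG : Differentiable ℂ G) :
    Differentiable ℂ (planarHelmholtz c G) := by
  have h0 := differentiable_dirDeriv (differentiable_dirDeriv hG (cdir 0)) (cdir 0)
  have h1 := differentiable_dirDeriv (differentiable_dirDeriv hG (cdir 1)) (cdir 1)
  unfold planarHelmholtz
  fun_prop

theorem differentiable_planarHelmholtz_iterate (hG : Differentiable ℂ G) (k : ℕ) :
    Differentiable ℂ ((planarHelmholtz c)^[k] G) := by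
  induction k with
  | zero => simpa using hG
  | succ k ih =>
    rw [Function.iterate_succ_apply']
    exact differentiable_planarHelmholtz ih

theorem dirDeriv_planarHelmholtz (hG : Differentiable ℂ G) (v : Fin 3 → ℂ) :
    dirDeriv v (planarHelmholtz c G) = planarHelmholtz c (dirDeriv v G) := by
  have hd : ∀ w, Differentiable ℂ (dirDeriv w G) := differentiable_dirDeriv hG
  have hdd : ∀ w w', Differentiable ℂ (dirDeriv w' (dirDeriv w G)) :=
    fun w w' => differentiable_dirDeriv (hd w) w'
  have hc : ∀ w, dirDeriv v (dirDeriv w (dirDeriv w G)) = dirDeriv w (dirDeriv w (dirDeriv v G)) :=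
    fun w => by
      rw [dirDeriv_comm (contDiff_of_differentiable (hd w) 2),
        dirDeriv_comm (contDiff_of_differentiable hG 2) v w]
  have e : planarHelmholtz c G = fun p => (dirDeriv (cdir 0) (dirDeriv (cdir 0) G) p +
      dirDeriv (cdir 1) (dirDeriv (cdir 1) G) p) + c ^ 2 * G p := rfl
  rw [e, dirDeriv_add ((hdd _ _).fun_add (hdd _ _)) (hG.const_mul _),
    dirDeriv_add (hdd _ _) (hdd _ _), dirDeriv_const_mul hG, hc, hc]
  rfl

theorem dirDeriv_planarHelmholtz_iterate (hG : Differentiable ℂ G) {v : Fin 3 → ℂ}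
    (hv : dirDeriv v G = 0) (k : ℕ) : dirDeriv v ((planarHelmholtz c)^[k] G) = 0 := by
  induction k with
  | zero => simpa using hv
  | succ k ih =>
    rw [Function.iterate_succ_apply',
      dirDeriv_planarHelmholtz (differentiable_planarHelmholtz_iterate hG k), ih]
    funext p
    simp [planarHelmholtz, dirDeriv_zero]

theorem norm_planarHelmholtz_le (hG : Differentiable ℂ G) {r δ M : ℝ} (hδ : 0 < δ)
    (hM : ∀ q ∈ closedBall (0 : Fin 3 → ℂ) (r + δ), ‖G q‖ ≤ M) :
    ∀ p ∈ closedBall (0 : Fin 3 → ℂ) r,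
      ‖planarHelmholtz c G p‖ ≤ (8 / δ ^ 2 + ‖c‖ ^ 2) * M := by
  -- Cauchy's estimate is used twice, each time giving up half of `δ`.
  have step : ∀ {g : (Fin 3 → ℂ) → ℂ} {s N : ℝ} (i : Fin 3), Differentiable ℂ g →
      (∀ q ∈ closedBall (0 : Fin 3 → ℂ) (s + δ / 2), ‖g q‖ ≤ N) →
      ∀ p ∈ closedBall (0 : Fin 3 → ℂ) s, ‖dirDeriv (cdir i) g p‖ ≤ N / (δ / 2) := by
    intro g s N i hg hN p hp
    have := norm_dirDeriv_le hg (half_pos hδ) (p := p) (M := N) (fun q hq => hN q ?_) (cdir i)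
    · rwa [cdir, Pi.norm_single, norm_one, mul_one] at this
    · rw [mem_closedBall_zero_iff] at *
      rw [mem_closedBall_iff_norm] at hq
      calc ‖q‖ = ‖p + (q - p)‖ := by congr 1; abel
        _ ≤ s + δ / 2 := (norm_add_le _ _).trans (add_le_add hp hq)
  have two : ∀ i : Fin 3, ∀ p ∈ closedBall (0 : Fin 3 → ℂ) r,
      ‖dirDeriv (cdir i) (dirDeriv (cdir i) G) p‖ ≤ M / (δ / 2) / (δ / 2) := fun i =>
    step i (differentiable_dirDeriv hG _) (step i hG (by
      rwa [show r + δ / 2 + δ / 2 = r + δ by ring]))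
  intro p hp
  have hp' : p ∈ closedBall (0 : Fin 3 → ℂ) (r + δ) := closedBall_subset_closedBall (by linarith) hp
  calc ‖planarHelmholtz c G p‖
      ≤ M / (δ / 2) / (δ / 2) + M / (δ / 2) / (δ / 2) + ‖c‖ ^ 2 * M := by
        refine (norm_add_le _ _).trans (add_le_add ((norm_add_le _ _).trans
          (add_le_add (two 0 p hp) (two 1 p hp))) ?_)
        rw [norm_mul, norm_pow]
        gcongr
        exact hM p hp'
    _ = _ := by field_simp; ring

theorem norm_planarHelmholtz_iterate_le (hG : Differentiable ℂ G) {δ M : ℝ} (hδ : 0 < δ) (k : ℕ) :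
    ∀ r : ℝ, (∀ q ∈ closedBall (0 : Fin 3 → ℂ) (r + k * δ), ‖G q‖ ≤ M) →
      ∀ p ∈ closedBall (0 : Fin 3 → ℂ) r,
        ‖(planarHelmholtz c)^[k] G p‖ ≤ (8 / δ ^ 2 + ‖c‖ ^ 2) ^ k * M := by
  induction k with
  | zero => intro r h p hp; simpa using h p (by simpa using hp)
  | succ k ih =>
    intro r h
    rw [Function.iterate_succ_apply', pow_succ', mul_assoc]
    refine norm_planarHelmholtz_le (differentiable_planarHelmholtz_iterate hG k) hδ (ih _ ?_)
    rwa [show r + δ + k * δ = r + ((k + 1 : ℕ) : ℝ) * δ by push_cast; ring]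

end PlanarHelmholtz

/-- The bounds that Cauchy's estimates give for the terms of the series on a ball of radius `r`, with
a total loss of radius `13 * r`, are summable. The point is `k ^ (2 * k) ≤ 9 ^ k * (2 * k + 1)!`,
and `13` is chosen so that the resulting geometric ratio `81 / 13 ^ 2` is less than one. -/
theorem summable_majorant (a : ℝ) {r : ℝ} (hr : 0 < r) :
    Summable fun k : ℕ => r ^ (2 * k + 1) / (2 * k + 1).factorial *
      (8 * (k / (13 * r)) ^ 2 + a ^ 2) ^ k := by
  have hgeo : Summable fun k : ℕ => r * (81 / 169 : ℝ) ^ k :=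
    (summable_geometric_of_lt_one (by norm_num) (by norm_num)).mul_left r
  refine Summable.of_norm_bounded_eventually_nat hgeo ?_
  filter_upwards [eventually_ge_atTop (Nat.ceil (|a| * (13 * r)))] with k hk
  have hk' : |a| * (13 * r) ≤ k := (Nat.le_ceil _).trans (by exact_mod_cast hk)
  have ha : a ^ 2 ≤ (k / (13 * r)) ^ 2 := by
    rw [← sq_abs]
    gcongr
    rwa [le_div_iff₀ (by positivity)]
  have hfac : (k : ℝ) ^ k ≤ 3 ^ k * k.factorial := by
    have h1 := Real.pow_div_factorial_le_exp (k : ℝ) (by positivity) k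
    rw [div_le_iff₀ (by positivity)] at h1
    refine h1.trans ?_
    gcongr
    rw [show (k : ℝ) = k * 1 by ring, Real.exp_nat_mul]
    gcongr
    exact Real.exp_one_lt_three.le
  have hfac2 : ((k : ℝ) ^ 2) ^ k ≤ 9 ^ k * (2 * k + 1).factorial := by
    have h2 : (k.factorial : ℝ) * k.factorial ≤ (2 * k + 1).factorial := by
      have h3 : k.factorial * k.factorial ≤ (k + k).factorial :=
        Nat.le_of_dvd (Nat.factorial_pos _) (Nat.factorial_mul_factorial_dvd_factorial_add k k)
      have h4 : (k + k).factorial ≤ (2 * k + 1).factorial := Nat.factorial_le (by omega)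
      exact_mod_cast h3.trans h4
    calc ((k : ℝ) ^ 2) ^ k = (k : ℝ) ^ k * (k : ℝ) ^ k := by rw [← pow_mul]; ring
      _ ≤ (3 ^ k * k.factorial) * (3 ^ k * k.factorial) := by gcongr
      _ = 9 ^ k * (k.factorial * k.factorial) := by
        rw [show (9 : ℝ) = 3 * 3 by norm_num, mul_pow]; ring
      _ ≤ _ := by gcongr
  rw [Real.norm_of_nonneg (by positivity)]
  calc r ^ (2 * k + 1) / (2 * k + 1).factorial * (8 * (k / (13 * r)) ^ 2 + a ^ 2) ^ k
      ≤ r ^ (2 * k + 1) / (2 * k + 1).factorial * (9 * (k / (13 * r)) ^ 2) ^ k := by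
        gcongr; linarith
    _ = r / (169 : ℝ) ^ k * 9 ^ k * (((k : ℝ) ^ 2) ^ k / (2 * k + 1).factorial) := by
        rw [div_pow, mul_pow, div_pow, mul_pow (13 : ℝ), mul_pow, ← pow_mul r, pow_succ]
        norm_num
        field_simp
    _ ≤ r / (169 : ℝ) ^ k * 9 ^ k * 9 ^ k := by
        gcongr
        rwa [div_le_iff₀ (by positivity)]
    _ = r * (81 / 169 : ℝ) ^ k := by
        rw [div_pow, show (81 : ℝ) = 9 * 9 by norm_num, mul_pow]; ring

/-- The `k`-th term of the series `∑ (-1)ᵏ z²ᵏ⁺¹ / (2k+1)! (∂₀² + ∂₁² + c²)ᵏ G`, where `z = p 2`. -/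
noncomputable def waveTerm (c : ℂ) (G : (Fin 3 → ℂ) → ℂ) (k : ℕ) : (Fin 3 → ℂ) → ℂ := fun p =>
  (-1) ^ k / (2 * k + 1).factorial * (p 2 ^ (2 * k + 1) * (planarHelmholtz c)^[k] G p)

section Wave

variable {c : ℂ} {G : (Fin 3 → ℂ) → ℂ}

theorem differentiable_waveTerm (hG : Differentiable ℂ G) (k : ℕ) :
    Differentiable ℂ (waveTerm c G k) := by
  have := differentiable_planarHelmholtz_iterate (c := c) hG k
  unfold waveTerm
  fun_prop

theorem locallySummable_waveTerm (hG : Differentiable ℂ G) : LocallySummable (waveTerm c G) where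
  differentiable := differentiable_waveTerm hG
  bound r := by
    set R : ℝ := max r 1 with hR
    have hR0 : 0 < R := by positivity
    obtain ⟨M, hM0, hM⟩ := exists_bound_closedBall hG (R + 13 * R)
    refine ⟨_, (summable_majorant ‖c‖ hR0).mul_right M, fun k p hp => ?_⟩
    have hp' : p ∈ closedBall (0 : Fin 3 → ℂ) R := closedBall_subset_closedBall (le_max_left _ _) hp
    have hp2 : ‖p 2‖ ≤ R := (norm_le_pi_norm p 2).trans (by simpa using hp')
    have hA : ‖(planarHelmholtz c)^[k] G p‖ ≤ (8 * (k / (13 * R)) ^ 2 + ‖c‖ ^ 2) ^ k * M := by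
      rcases Nat.eq_zero_or_pos k with rfl | hk
      · simpa using hM p (closedBall_subset_closedBall (by linarith) hp')
      · have hk' : (0 : ℝ) < k := by exact_mod_cast hk
        -- The total loss of radius over `k` steps is `13 * R`.
        have := norm_planarHelmholtz_iterate_le (c := c) hG (δ := 13 * R / k) (M := M)
          (by positivity) k R (by rwa [mul_div_cancel₀ _ hk'.ne']) p hp'
        convert this using 4
        field_simp
    have h1 : ‖(-1 : ℂ) ^ k / (2 * k + 1).factorial‖ = 1 / (2 * k + 1).factorial := by
      simp
    rw [waveTerm, norm_mul, h1, norm_mul, norm_pow]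
    calc 1 / ((2 * k + 1).factorial : ℝ) * (‖p 2‖ ^ (2 * k + 1) * ‖(planarHelmholtz c)^[k] G p‖)
        ≤ 1 / ((2 * k + 1).factorial : ℝ) *
          (R ^ (2 * k + 1) * ((8 * (k / (13 * R)) ^ 2 + ‖c‖ ^ 2) ^ k * M)) := by gcongr
      _ = _ := by ring

theorem hasFDerivAt_vertical_pow (m : ℕ) (p : Fin 3 → ℂ) :
    HasFDerivAt (fun q : Fin 3 → ℂ => q 2 ^ m)
      ((m * p 2 ^ (m - 1)) • (ContinuousLinearMap.proj 2 : (Fin 3 → ℂ) →L[ℂ] ℂ)) p := by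
  have h := ((ContinuousLinearMap.proj 2 : (Fin 3 → ℂ) →L[ℂ] ℂ).hasFDerivAt (x := p)).pow m
  refine (h.congr_of_eventuallyEq (Eventually.of_forall fun _ => rfl)).congr_fderiv ?_
  ext v
  simp

theorem dirDeriv_pow_mul {g : (Fin 3 → ℂ) → ℂ} (hg : Differentiable ℂ g) (m : ℕ) (a : ℂ)
    (v : Fin 3 → ℂ) :
    dirDeriv v (fun p => a * (p 2 ^ m * g p)) =
      fun p => a * (p 2 ^ m * dirDeriv v g p + m * p 2 ^ (m - 1) * v 2 * g p) := by
  have hm : Differentiable ℂ fun q : Fin 3 → ℂ => q 2 ^ m := by fun_prop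
  rw [dirDeriv_const_mul (hm.fun_mul hg)]
  funext p
  rw [dirDeriv_mul (hm p) (hg p), dirDeriv_eq (hasFDerivAt_vertical_pow m p)]
  simp

theorem dirDeriv_horizontal_waveTerm (hG : Differentiable ℂ G) {v : Fin 3 → ℂ} (hv : v 2 = 0)
    (k : ℕ) : dirDeriv v (dirDeriv v (waveTerm c G k)) = fun p =>
      (-1) ^ k / (2 * k + 1).factorial *
        (p 2 ^ (2 * k + 1) * dirDeriv v (dirDeriv v ((planarHelmholtz c)^[k] G)) p) := by
  have hA := differentiable_planarHelmholtz_iterate (c := c) hG k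
  unfold waveTerm
  rw [dirDeriv_pow_mul hA]
  simp only [hv, mul_zero, zero_mul, add_zero]
  rw [dirDeriv_pow_mul (differentiable_dirDeriv hA v)]
  simp only [hv, mul_zero, zero_mul, add_zero]

theorem dirDeriv_vertical_waveTerm (hG : Differentiable ℂ G) (hz : dirDeriv (cdir 2) G = 0)
    (k : ℕ) : dirDeriv (cdir 2) (waveTerm c G k) = fun p =>
      (-1) ^ k / (2 * k).factorial * (p 2 ^ (2 * k) * (planarHelmholtz c)^[k] G p) := by
  have hA := differentiable_planarHelmholtz_iterate (c := c) hG k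
  unfold waveTerm
  rw [dirDeriv_pow_mul hA, dirDeriv_planarHelmholtz_iterate hG hz]
  funext p
  have : ((2 * k + 1).factorial : ℂ) = (2 * k + 1) * (2 * k).factorial := by
    rw [Nat.factorial_succ]; push_cast; ring
  have h0 : (2 * k + 1 : ℂ) ≠ 0 := by exact_mod_cast Nat.succ_ne_zero (2 * k)
  have h1 : ((2 * k).factorial : ℂ) ≠ 0 := by exact_mod_cast Nat.factorial_ne_zero _
  simp only [this, Pi.single_eq_same, Nat.add_sub_cancel, Pi.zero_apply]
  push_cast
  field_simp
  ring

theorem dirDeriv_vertical_twice_waveTerm_zero (hG : Differentiable ℂ G)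
    (hz : dirDeriv (cdir 2) G = 0) :
    dirDeriv (cdir 2) (dirDeriv (cdir 2) (waveTerm c G 0)) = 0 := by
  rw [dirDeriv_vertical_waveTerm hG hz]
  simpa using hz

theorem dirDeriv_vertical_twice_waveTerm_succ (hG : Differentiable ℂ G)
    (hz : dirDeriv (cdir 2) G = 0) (k : ℕ) :
    dirDeriv (cdir 2) (dirDeriv (cdir 2) (waveTerm c G (k + 1))) =
      fun p => -planarHelmholtz c (waveTerm c G k) p := by
  have hA := differentiable_planarHelmholtz_iterate (c := c) hG (k + 1)
  rw [dirDeriv_vertical_waveTerm hG hz, dirDeriv_pow_mul hA,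
    dirDeriv_planarHelmholtz_iterate hG hz]
  funext p
  have e0 : (cdir 0) 2 = 0 := by simp [cdir]
  have e1 : (cdir 1) 2 = 0 := by simp [cdir]
  rw [planarHelmholtz, dirDeriv_horizontal_waveTerm hG e0, dirDeriv_horizontal_waveTerm hG e1,
    Function.iterate_succ_apply', planarHelmholtz, waveTerm]
  have : ((2 * (k + 1)).factorial : ℂ) = (2 * k + 2) * (2 * k + 1).factorial := by
    rw [show 2 * (k + 1) = (2 * k + 1) + 1 by ring, Nat.factorial_succ]; push_cast; ring
  have h0 : (2 * k + 2 : ℂ) ≠ 0 := by exact_mod_cast Nat.succ_ne_zero (2 * k + 1)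
  have h1 : ((2 * k + 1).factorial : ℂ) ≠ 0 := by exact_mod_cast Nat.factorial_ne_zero _
  simp only [this, Pi.single_eq_same, Pi.zero_apply,
    show 2 * (k + 1) - 1 = 2 * k + 1 by omega]
  push_cast
  field_simp
  ring

/-- The solution `W` of `ΔW + c² W = 0` with `W = 0` and `∂₂W = G` on the plane `p 2 = 0`. -/
noncomputable def wavePotential (c : ℂ) (G : (Fin 3 → ℂ) → ℂ) : (Fin 3 → ℂ) → ℂ :=
  fun p => ∑' k, waveTerm c G k p

theorem differentiable_wavePotential (hG : Differentiable ℂ G) :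
    Differentiable ℂ (wavePotential c G) :=
  (locallySummable_waveTerm hG).differentiable_tsum

theorem wavePotential_helmholtz (hG : Differentiable ℂ G) (hz : dirDeriv (cdir 2) G = 0)
    (p : Fin 3 → ℂ) :
    dirDeriv (cdir 2) (dirDeriv (cdir 2) (wavePotential c G)) p =
      -planarHelmholtz c (wavePotential c G) p := by
  have hs := locallySummable_waveTerm (c := c) hG
  have two : ∀ v, dirDeriv v (dirDeriv v (wavePotential c G)) =
      fun q => ∑' k, dirDeriv v (dirDeriv v (waveTerm c G k)) q := by
    intro v
    unfold wavePotential
    rw [hs.dirDeriv_tsum, (hs.dirDeriv v).dirDeriv_tsum]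
  have hsum : ∀ v, Summable fun k => dirDeriv v (dirDeriv v (waveTerm c G k)) p :=
    fun v => ((hs.dirDeriv v).dirDeriv v).summable p
  rw [planarHelmholtz, two, two, two]
  simp only
  rw [(hsum (cdir 2)).tsum_eq_zero_add, dirDeriv_vertical_twice_waveTerm_zero hG hz]
  simp only [dirDeriv_vertical_twice_waveTerm_succ hG hz, Pi.zero_apply, zero_add]
  rw [tsum_neg]
  simp only [planarHelmholtz]
  rw [((hsum (cdir 0)).add (hsum (cdir 1))).tsum_add ((hs.summable p).mul_left _),
    (hsum (cdir 0)).tsum_add (hsum (cdir 1)), tsum_mul_left]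
  rfl

theorem wavePotential_of_vertical_eq_zero {p : Fin 3 → ℂ} (hp : p 2 = 0) :
    wavePotential c G p = 0 := by
  simp [wavePotential, waveTerm, hp]

theorem dirDeriv_wavePotential_of_vertical_eq_zero (hG : Differentiable ℂ G)
    (hz : dirDeriv (cdir 2) G = 0) {p : Fin 3 → ℂ} (hp : p 2 = 0) :
    dirDeriv (cdir 2) (wavePotential c G) p = G p := by
  unfold wavePotential
  rw [(locallySummable_waveTerm hG).dirDeriv_tsum]
  simp only [dirDeriv_vertical_waveTerm hG hz, hp]
  rw [tsum_eq_single 0 (fun k hk => by simp [hk])]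
  simp

end Wave

/-! ### Passage to real points and the entire Beltrami field -/

/-- A complex function on `ℂⁿ` that takes real values at real points. -/
def RealOnReals {n : ℕ} (G : (Fin n → ℂ) → ℂ) : Prop :=
  ∀ x : Fin n → ℝ, (G fun i => (x i : ℂ)).im = 0

namespace RealOnReals

variable {n : ℕ} {G : (Fin n → ℂ) → ℂ}

protected theorem dirDeriv (hG : Differentiable ℂ G) (hr : RealOnReals G) (i : Fin n) :
    RealOnReals (dirDeriv (Pi.single i 1) G) := by
  intro x
  set p : Fin n → ℂ := fun j => (x j : ℂ) with hp
  have h1 : HasDerivAt (fun t : ℂ => G (p + t • Pi.single i 1)) (dirDeriv (Pi.single i 1) G p)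
      ((0 : ℝ) : ℂ) := by
    have := (hG p).hasFDerivAt.hasLineDerivAt (Pi.single i 1)
    simpa [HasLineDerivAt, dirDeriv] using this
  have h2 := Complex.imCLM.hasFDerivAt.comp_hasDerivAt (0 : ℝ) h1.comp_ofReal
  have h3 : (Complex.imCLM ∘ fun t : ℝ => G (p + (t : ℂ) • Pi.single i 1)) = fun _ => (0 : ℝ) := by
    funext t
    have := hr (x + t • Pi.single i 1)
    simp only [Function.comp_apply, Complex.imCLM_apply]
    convert this using 3
    funext j
    rcases eq_or_ne j i with rfl | hj
    · simp [hp]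
    · simp [hp, hj]
  rw [h3] at h2
  exact h2.unique (hasDerivAt_const (0 : ℝ) (0 : ℝ))

theorem add {H : (Fin n → ℂ) → ℂ} (hG : RealOnReals G) (hH : RealOnReals H) :
    RealOnReals fun p => G p + H p := fun x => by simp [hG x, hH x]

theorem neg (hG : RealOnReals G) : RealOnReals fun p => -G p := fun x => by simp [hG x]

theorem const_mul (hG : RealOnReals G) (a : ℝ) : RealOnReals fun p => a * G p :=
  fun x => by simp [hG x]

theorem mul {H : (Fin n → ℂ) → ℂ} (hG : RealOnReals G) (hH : RealOnReals H) :
    RealOnReals fun p => G p * H p := fun x => by simp [hG x, hH x]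

theorem coord_pow (i : Fin n) (m : ℕ) : RealOnReals fun p : Fin n → ℂ => p i ^ m := fun x => by
  simp only [← Complex.ofReal_pow, Complex.ofReal_im]

theorem tsum {f : ℕ → (Fin n → ℂ) → ℂ} (hf : LocallySummable f) (hr : ∀ k, RealOnReals (f k)) :
    RealOnReals fun p => ∑' k, f k p := fun x => by
  rw [Complex.im_tsum (hf.summable _)]
  simp [fun k => hr k x]

end RealOnReals

theorem realOnReals_planarHelmholtz {c : ℝ} {G : (Fin 3 → ℂ) → ℂ} (hG : Differentiable ℂ G)
    (hr : RealOnReals G) : RealOnReals (planarHelmholtz c G) := by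
  have h2 : ∀ i, RealOnReals (dirDeriv (cdir i) (dirDeriv (cdir i) G)) := fun i =>
    (hr.dirDeriv hG i).dirDeriv (differentiable_dirDeriv hG _) i
  have := ((h2 0).add (h2 1)).add (hr.const_mul (c ^ 2))
  simp only [Complex.ofReal_pow] at this
  exact this

theorem realOnReals_wavePotential {c : ℝ} {G : (Fin 3 → ℂ) → ℂ} (hG : Differentiable ℂ G)
    (hr : RealOnReals G) : RealOnReals (wavePotential c G) := by
  refine RealOnReals.tsum (locallySummable_waveTerm hG) fun k => ?_
  have hA : RealOnReals ((planarHelmholtz (c : ℂ))^[k] G) := by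
    induction k with
    | zero => simpa using hr
    | succ k ih =>
      rw [Function.iterate_succ_apply']
      exact realOnReals_planarHelmholtz (differentiable_planarHelmholtz_iterate hG k) ih
  have := ((RealOnReals.coord_pow 2 (2 * k + 1)).mul hA).const_mul
    ((-1) ^ k / (2 * k + 1).factorial)
  simp only [Complex.ofReal_div, Complex.ofReal_pow, Complex.ofReal_neg, Complex.ofReal_one,
    Complex.ofReal_natCast] at this
  exact this

/-- The inclusion of `ℝⁿ` in `ℂⁿ`. -/
noncomputable def complexify (n : ℕ) : EuclideanSpace ℝ (Fin n) →L[ℝ] (Fin n → ℂ) :=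
  ContinuousLinearMap.pi fun i => Complex.ofRealCLM.comp (EuclideanSpace.proj i)

theorem complexify_apply {n : ℕ} (p : EuclideanSpace ℝ (Fin n)) :
    complexify n p = fun i => (p i : ℂ) := rfl

theorem complexify_single {n : ℕ} (i : Fin n) :
    complexify n (EuclideanSpace.single i 1) = Pi.single i 1 := by
  funext j
  rcases eq_or_ne j i with rfl | hj
  · simp [complexify_apply]
  · simp [complexify_apply, hj]

/-- The real part of the restriction of a function on `ℂⁿ` to `ℝⁿ`. -/
noncomputable def realRestrict {n : ℕ} (G : (Fin n → ℂ) → ℂ) : EuclideanSpace ℝ (Fin n) → ℝ :=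
  fun p => (G (complexify n p)).re

section RealRestrict

variable {n : ℕ} {G : (Fin n → ℂ) → ℂ}

theorem isEntire_realRestrict (hG : Differentiable ℂ G) (hr : RealOnReals G) :
    IsEntire (realRestrict G) :=
  ⟨G, hG, fun p => Complex.ext (by simp [realRestrict, complexify_apply])
    (by simpa using hr fun i => p i)⟩

theorem contDiff_realRestrict (hG : Differentiable ℂ G) (m : ℕ) : ContDiff ℝ m (realRestrict G) :=
  Complex.reCLM.contDiff.comp
    (((contDiff_of_differentiable hG m).restrict_scalars ℝ).comp (complexify n).contDiff)

theorem dirDeriv_realRestrict (hG : Differentiable ℂ G) (i : Fin n) :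
    dirDeriv (EuclideanSpace.single i (1 : ℝ)) (realRestrict G) =
      realRestrict (dirDeriv (Pi.single i 1) G) := by
  funext p
  have h1 := ((hG (complexify n p)).hasFDerivAt.restrictScalars ℝ).comp p
    (complexify n).hasFDerivAt
  have h2 : HasFDerivAt (realRestrict G) _ p := Complex.reCLM.hasFDerivAt.comp p h1
  rw [dirDeriv_eq h2]
  simp [realRestrict, dirDeriv, complexify_single]

end RealRestrict

/-- The coordinate directions of `ℝ³`. -/
noncomputable abbrev rdir (i : Fin 3) : EuclideanSpace ℝ (Fin 3) := EuclideanSpace.single i 1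

theorem pderivComp_eq_dirDeriv {u : EuclideanSpace ℝ (Fin 3) → EuclideanSpace ℝ (Fin 3)}
    (hu : Differentiable ℝ u) (i j : Fin 3) :
    pderivComp u i j = dirDeriv (rdir i) fun p => u p j := by
  funext p
  have : HasFDerivAt (fun p => u p j)
      ((EuclideanSpace.proj j : EuclideanSpace ℝ (Fin 3) →L[ℝ] ℝ).comp (fderiv ℝ u p)) p :=
    (EuclideanSpace.proj j : EuclideanSpace ℝ (Fin 3) →L[ℝ] ℝ).hasFDerivAt.comp p
      (hu p).hasFDerivAt
  rw [dirDeriv_eq this]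
  rfl

/-- The field `curl curl (W e₂) + lam curl (W e₂)`. -/
noncomputable def potentialField (lam : ℝ) (W : EuclideanSpace ℝ (Fin 3) → ℝ) :
    EuclideanSpace ℝ (Fin 3) → EuclideanSpace ℝ (Fin 3) := fun p =>
  !₂[dirDeriv (rdir 0) (dirDeriv (rdir 2) W) p + lam * dirDeriv (rdir 1) W p,
    dirDeriv (rdir 1) (dirDeriv (rdir 2) W) p + -(lam * dirDeriv (rdir 0) W p),
    -(dirDeriv (rdir 0) (dirDeriv (rdir 0) W) p + dirDeriv (rdir 1) (dirDeriv (rdir 1) W) p)]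

/-- If `ΔW + lam² W = 0` then `curl curl (W e₂) + lam curl (W e₂)` is a Beltrami field. -/
theorem isBeltramiField_potentialField {lam : ℝ} (hlam : lam ≠ 0)
    {W : EuclideanSpace ℝ (Fin 3) → ℝ} (hW : ContDiff ℝ 3 W)
    (hpde : ∀ p, dirDeriv (rdir 2) (dirDeriv (rdir 2) W) p =
      -(dirDeriv (rdir 0) (dirDeriv (rdir 0) W) p + dirDeriv (rdir 1) (dirDeriv (rdir 1) W) p
        + lam ^ 2 * W p)) :
    IsBeltramiField lam (potentialField lam W) := by
  have c1 : ∀ i, ContDiff ℝ 2 (dirDeriv (rdir i) W) := fun i =>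
    contDiff_dirDeriv hW (by norm_num) _
  have c2 : ∀ i j, ContDiff ℝ 1 (dirDeriv (rdir j) (dirDeriv (rdir i) W)) := fun i j =>
    contDiff_dirDeriv (c1 i) (by norm_num) _
  have d0 : Differentiable ℝ W := hW.differentiable (by norm_num)
  have d1 : ∀ i, Differentiable ℝ (dirDeriv (rdir i) W) := fun i =>
    (c1 i).differentiable (by norm_num)
  have d2 : ∀ i j, Differentiable ℝ (dirDeriv (rdir j) (dirDeriv (rdir i) W)) := fun i j =>
    (c2 i j).differentiable (by norm_num)
  have hu : ContDiff ℝ 1 (potentialField lam W) := by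
    rw [contDiff_euclidean]
    have c1' : ∀ i, ContDiff ℝ 1 (dirDeriv (rdir i) W) := fun i => (c1 i).of_le (by norm_num)
    intro i
    fin_cases i
    · exact (c2 2 0).add (contDiff_const.mul (c1' 1))
    · exact (c2 2 1).add (contDiff_const.mul (c1' 0)).neg
    · exact ((c2 0 0).add (c2 1 1)).neg
  refine ⟨hlam, hu, fun p => ?_⟩
  have comm : ∀ i j, dirDeriv (rdir i) (dirDeriv (rdir j) W) =
      dirDeriv (rdir j) (dirDeriv (rdir i) W) :=
    fun i j => dirDeriv_comm (hW.of_le (by norm_num)) _ _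
  have comm' : ∀ i j k, dirDeriv (rdir i) (dirDeriv (rdir j) (dirDeriv (rdir k) W)) =
      dirDeriv (rdir j) (dirDeriv (rdir i) (dirDeriv (rdir k) W)) :=
    fun i j k => dirDeriv_comm (c1 k) _ _
  have e0 : ∀ i, dirDeriv (rdir i) (fun p => potentialField lam W p 0) = fun p =>
      dirDeriv (rdir i) (dirDeriv (rdir 0) (dirDeriv (rdir 2) W)) p +
        lam * dirDeriv (rdir i) (dirDeriv (rdir 1) W) p := fun i =>
    (dirDeriv_add (d2 2 0) ((d1 1).const_mul lam) _).trans (by rw [dirDeriv_const_mul (d1 1)])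
  have e1 : ∀ i, dirDeriv (rdir i) (fun p => potentialField lam W p 1) = fun p =>
      dirDeriv (rdir i) (dirDeriv (rdir 1) (dirDeriv (rdir 2) W)) p +
        -(lam * dirDeriv (rdir i) (dirDeriv (rdir 0) W) p) := fun i =>
    (dirDeriv_add (d2 2 1) ((d1 0).const_mul lam).fun_neg _).trans
      (by rw [dirDeriv_neg, dirDeriv_const_mul (d1 0)])
  have e2 : ∀ i, dirDeriv (rdir i) (fun p => potentialField lam W p 2) = fun p =>
      -(dirDeriv (rdir i) (dirDeriv (rdir 0) (dirDeriv (rdir 0) W)) p +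
        dirDeriv (rdir i) (dirDeriv (rdir 1) (dirDeriv (rdir 1) W)) p) := fun i =>
    (dirDeriv_neg _ _).trans (by rw [dirDeriv_add (d2 0 0) (d2 1 1)])
  -- The horizontal derivatives of the equation for `W`.
  have hpde' : ∀ i, dirDeriv (rdir i) (dirDeriv (rdir 2) (dirDeriv (rdir 2) W)) = fun p =>
      -((dirDeriv (rdir i) (dirDeriv (rdir 0) (dirDeriv (rdir 0) W)) p +
        dirDeriv (rdir i) (dirDeriv (rdir 1) (dirDeriv (rdir 1) W)) p) +
          lam ^ 2 * dirDeriv (rdir i) W p) := fun i => by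
    rw [funext hpde, dirDeriv_neg, dirDeriv_add ((d2 0 0).fun_add (d2 1 1)) (d0.const_mul _),
      dirDeriv_add (d2 0 0) (d2 1 1), dirDeriv_const_mul d0]
  have hd := hu.differentiable (by norm_num)
  have x1 := congrFun (hpde' 1) p
  have x0 := congrFun (hpde' 0) p
  have y1 : dirDeriv (rdir 2) (dirDeriv (rdir 1) (dirDeriv (rdir 2) W)) p =
      dirDeriv (rdir 1) (dirDeriv (rdir 2) (dirDeriv (rdir 2) W)) p := by rw [comm']
  have y0 : dirDeriv (rdir 2) (dirDeriv (rdir 0) (dirDeriv (rdir 2) W)) p =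
      dirDeriv (rdir 0) (dirDeriv (rdir 2) (dirDeriv (rdir 2) W)) p := by rw [comm']
  ext i
  fin_cases i
  · simp only [curl, pderivComp_eq_dirDeriv hd, e1, e2]
    simp [potentialField]
    rw [y1, x1, comm 2 0]
    ring
  · simp only [curl, pderivComp_eq_dirDeriv hd, e0, e2]
    simp [potentialField]
    rw [y0, x0, comm 2 1]
    ring
  · simp only [curl, pderivComp_eq_dirDeriv hd, e0, e1]
    simp [potentialField]
    rw [comm' 0 1 2]
    ring

/-- Existence for the Cauchy problem: a real entire function `F` of two variables is the potential
of the Cauchy datum of a Beltrami field with entire components. -/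
theorem exists_entire_beltramiField {F : EuclideanSpace ℝ (Fin 2) → ℝ} (hF : IsEntire F)
    {lam : ℝ} (hlam : lam ≠ 0) :
    ∃ u : EuclideanSpace ℝ (Fin 3) → EuclideanSpace ℝ (Fin 3),
      IsBeltramiField lam u ∧ HasGradientDatum F u ∧ ∀ i : Fin 3, IsEntire (fun p => u p i) := by
  obtain ⟨G₀, hG₀, hGF⟩ := hF
  have hFG : F = realRestrict G₀ := funext fun p => by
    simp [realRestrict, complexify_apply, hGF p]
  -- `G` is `G₀`, made constant in the third variable.
  let π : (Fin 3 → ℂ) →L[ℂ] (Fin 2 → ℂ) :=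
    ContinuousLinearMap.pi fun i => ContinuousLinearMap.proj i.castSucc
  let G : (Fin 3 → ℂ) → ℂ := fun p => G₀ (π p)
  have hπ : ∀ p i, π p i = p i.castSucc := fun _ _ => rfl
  have hG : Differentiable ℂ G := hG₀.comp π.differentiable
  have hGd : ∀ v p, dirDeriv v G p = dirDeriv (π v) G₀ (π p) := fun v p =>
    dirDeriv_eq ((hG₀ (π p)).hasFDerivAt.comp p π.hasFDerivAt) v
  have hz : dirDeriv (cdir 2) G = 0 := by
    funext p
    have : π (cdir 2) = 0 := by
      funext i
      fin_cases i <;> simp [hπ, cdir]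
    rw [hGd, this]
    simp [dirDeriv]
  have hr : RealOnReals G := fun x => by
    have : π (fun i => (x i : ℂ)) = fun i => ((WithLp.toLp 2 fun j => x (Fin.castSucc j) :
      EuclideanSpace ℝ (Fin 2)) i : ℂ) := rfl
    simp only [G]
    rw [this, hGF, Complex.ofReal_im]
  set V := wavePotential (lam : ℂ) G with hV
  have hVd : Differentiable ℂ V := differentiable_wavePotential hG
  have hVr : RealOnReals V := realOnReals_wavePotential hG hr
  have hV1 : ∀ i, Differentiable ℂ (dirDeriv (cdir i) V) := fun i => differentiable_dirDeriv hVd _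
  have hV2 : ∀ i j, Differentiable ℂ (dirDeriv (cdir j) (dirDeriv (cdir i) V)) := fun i j =>
    differentiable_dirDeriv (hV1 i) _
  have r1 : ∀ i, RealOnReals (dirDeriv (cdir i) V) := fun i => hVr.dirDeriv hVd i
  have r2 : ∀ i j, RealOnReals (dirDeriv (cdir j) (dirDeriv (cdir i) V)) := fun i j =>
    (r1 i).dirDeriv (hV1 i) j
  let W := realRestrict V
  have w1 : ∀ i, dirDeriv (rdir i) W = realRestrict (dirDeriv (cdir i) V) := fun i =>
    dirDeriv_realRestrict hVd i
  have w2 : ∀ i j, dirDeriv (rdir j) (realRestrict (dirDeriv (cdir i) V)) =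
      realRestrict (dirDeriv (cdir j) (dirDeriv (cdir i) V)) := fun i j =>
    dirDeriv_realRestrict (hV1 i) j
  refine ⟨potentialField lam W, isBeltramiField_potentialField hlam (contDiff_realRestrict hVd 3)
    fun p => ?_, fun x y => ?_, fun i => ?_⟩
  · have := congrArg Complex.re (wavePotential_helmholtz (c := lam) hG hz (complexify 3 p))
    simp only [w1, w2]
    simp only [planarHelmholtz, ← Complex.ofReal_pow, Complex.neg_re, Complex.add_re,
      Complex.re_ofReal_mul] at this
    exact this
  · -- Derivatives along the plane only see the values on the plane.
    set p : EuclideanSpace ℝ (Fin 3) := !₂[x, y, 0] with hp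
    have hplane : ∀ i : Fin 3, i ≠ 2 → ∀ t : ℂ, (complexify 3 p + t • cdir i) 2 = 0 := by
      intro i hi t
      simp [complexify_apply, hp, cdir, hi.symm]
    have hp2 : complexify 3 p 2 = 0 := by simp [complexify_apply, hp]
    have t1 : ∀ i : Fin 3, i ≠ 2 → ∀ q : Fin 3 → ℂ, q 2 = 0 → dirDeriv (cdir i) V q = 0 := by
      intro i hi q hq
      rw [dirDeriv_eq_of_eq_on_line (g := 0) (hVd q) (by fun_prop) fun t => ?_]
      · simp
      · exact wavePotential_of_vertical_eq_zero (by simp [hq, cdir, hi.symm])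
    have t2 : ∀ i : Fin 3, i ≠ 2 → dirDeriv (cdir i) (dirDeriv (cdir i) V) (complexify 3 p) = 0 := by
      intro i hi
      rw [dirDeriv_eq_of_eq_on_line (g := 0) (hV1 i _) (by fun_prop) fun t => ?_]
      · simp
      · exact t1 i hi _ (hplane i hi t)
    have t3 : ∀ i : Fin 3, i ≠ 2 → dirDeriv (cdir i) (dirDeriv (cdir 2) V) (complexify 3 p) =
        dirDeriv (π (cdir i)) G₀ (π (complexify 3 p)) := by
      intro i hi
      rw [dirDeriv_eq_of_eq_on_line (g := G) (hV1 2 _) (hG _) fun t => ?_, hGd]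
      exact dirDeriv_wavePotential_of_vertical_eq_zero hG hz (hplane i hi t)
    have hgrad : ∀ i : Fin 2, (∇ F !₂[x, y]) i =
        (dirDeriv (Pi.single i 1) G₀ (π (complexify 3 p))).re := by
      intro i
      have hd : DifferentiableAt ℝ F !₂[x, y] := by
        rw [hFG]
        exact (contDiff_realRestrict hG₀ 1).differentiable (by norm_num) _
      have e1 : (∇ F !₂[x, y]) i = dirDeriv (EuclideanSpace.single i (1 : ℝ)) F !₂[x, y] := by
        rw [dirDeriv_eq hd.hasGradientAt.hasFDerivAt]
        rw [InnerProductSpace.toDual_apply_apply, EuclideanSpace.inner_single_right]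
        simp
      have e2 : complexify 2 !₂[x, y] = π (complexify 3 p) := by
        funext j
        fin_cases j <;> simp [complexify_apply, hπ, hp]
      rw [e1, hFG, dirDeriv_realRestrict hG₀, realRestrict, e2]
    have s0 : π (cdir 0) = Pi.single 0 1 := by
      funext i
      fin_cases i <;> simp [hπ, cdir]
    have s1 : π (cdir 1) = Pi.single 1 1 := by
      funext i
      fin_cases i <;> simp [hπ, cdir]
    ext i
    fin_cases i
    · simp [potentialField, w1, w2, realRestrict, t3 0, t1 1 (by decide) _ hp2, hgrad, s0]
    · simp [potentialField, w1, w2, realRestrict, t3 1, t1 0 (by decide) _ hp2, hgrad, s1]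
    · simp [potentialField, w1, w2, realRestrict, t2 0, t2 1]
  · fin_cases i
    · convert isEntire_realRestrict ((hV2 2 0).fun_add ((hV1 1).const_mul (lam : ℂ)))
        ((r2 2 0).add ((r1 1).const_mul lam)) using 1
      funext p
      simp [potentialField, w1, w2, realRestrict]
    · convert isEntire_realRestrict ((hV2 2 1).fun_add ((hV1 0).const_mul (lam : ℂ)).fun_neg)
        ((r2 2 1).add ((r1 0).const_mul lam).neg) using 1
      funext p
      simp [potentialField, w1, w2, realRestrict]
    · convert isEntire_realRestrict ((hV2 0 0).fun_add (hV2 1 1)).fun_neg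
        ((r2 0 0).add (r2 1 1)).neg using 1
      funext p
      simp [potentialField, w1, w2, realRestrict]

/-! ### Weak form of the Beltrami equation on a half space -/

/-- The open half space above the plane `{p | p 2 = 0}` if `σ > 0`, and the one below if `σ < 0`. -/
def halfSpace (σ : ℝ) : Set (EuclideanSpace ℝ (Fin 3)) := {p | 0 < σ * p 2}

theorem isOpen_halfSpace (σ : ℝ) : IsOpen (halfSpace σ) :=
  isOpen_lt continuous_const (by fun_prop)

/-- Truncating a function that vanishes on the plane does not increase its Lipschitz constant: a
segment that leaves the half space passes through the plane. -/
theorem lipschitzWith_indicator_halfSpace {g : EuclideanSpace ℝ (Fin 3) → ℝ} {C : NNReal}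
    (hg : LipschitzWith C g) (h0 : ∀ p, p 2 = 0 → g p = 0) (σ : ℝ) :
    LipschitzWith C ((halfSpace σ).indicator g) := by
  have key : ∀ p q, p ∈ halfSpace σ → q ∉ halfSpace σ → |g p| ≤ C * dist p q := by
    intro p q hp hq
    simp only [halfSpace, mem_ofPred_eq, not_lt] at hp hq
    set t : ℝ := σ * p 2 / (σ * p 2 - σ * q 2) with ht
    have hden : 0 < σ * p 2 - σ * q 2 := by linarith
    have ht0 : 0 ≤ t := by positivity
    have ht1 : t ≤ 1 := by rw [ht, div_le_one hden]; linarith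
    have hσ : σ ≠ 0 := by rintro rfl; simp at hp
    have hr : (p + t • (q - p)) 2 = 0 := by
      have : σ * (p 2 + t * (q 2 - p 2)) = 0 := by
        linear_combination -div_mul_cancel₀ (σ * p 2) hden.ne'
      simpa [hσ] using this
    calc |g p| = dist (g p) (g (p + t • (q - p))) := by rw [h0 _ hr, Real.dist_eq, sub_zero]
      _ ≤ C * dist p (p + t • (q - p)) := hg.dist_le_mul _ _
      _ ≤ C * dist p q := by
        gcongr
        rw [dist_self_add_right, norm_smul, Real.norm_of_nonneg ht0, dist_comm, dist_eq_norm]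
        exact mul_le_of_le_one_left (norm_nonneg _) ht1
  refine LipschitzWith.of_dist_le_mul fun p q => ?_
  by_cases hp : p ∈ halfSpace σ <;> by_cases hq : q ∈ halfSpace σ
  · simpa [hp, hq] using hg.dist_le_mul p q
  · simpa [hp, hq, Real.dist_eq] using key p q hp hq
  · simpa [hp, hq, Real.dist_eq, dist_comm] using key q p hq hp
  · simp only [hp, hq, not_false_eq_true, indicator_of_notMem, dist_self]
    positivity

theorem ae_vertical_ne_zero : ∀ᵐ p : EuclideanSpace ℝ (Fin 3), p 2 ≠ 0 := by
  let S : Submodule ℝ (EuclideanSpace ℝ (Fin 3)) :=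
    LinearMap.ker (EuclideanSpace.proj (2 : Fin 3) : EuclideanSpace ℝ (Fin 3) →L[ℝ] ℝ).toLinearMap
  have hS : S ≠ ⊤ := by
    intro h
    have : rdir 2 ∈ S := h ▸ Submodule.mem_top
    simp [S] at this
  have := Measure.addHaar_submodule volume S hS
  rw [ae_iff]
  convert this using 2
  ext p
  simp [S]

/-- The integral over a half space of a derivative of a compactly supported function vanishes if
the function vanishes on the boundary plane. -/
theorem integral_halfSpace_dirDeriv {g : EuclideanSpace ℝ (Fin 3) → ℝ} (hg : ContDiff ℝ 1 g)
    (hc : HasCompactSupport g) (h0 : ∀ p, p 2 = 0 → g p = 0) (σ : ℝ) (hσ : σ ≠ 0)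
    (v : EuclideanSpace ℝ (Fin 3)) : ∫ p in halfSpace σ, dirDeriv v g p = 0 := by
  obtain ⟨C, hC⟩ := hg.lipschitzWith_of_hasCompactSupport hc one_ne_zero
  have hL := lipschitzWith_indicator_halfSpace hC h0 σ
  have hcs : HasCompactSupport ((halfSpace σ).indicator g) :=
    hc.mono (by rw [support_indicator]; exact inter_subset_right)
  -- Integration by parts against the constant function `1`.
  have h1 := LipschitzWith.integral_lineDeriv_mul_eq (μ := volume) (LipschitzWith.const (1 : ℝ))
    hL hcs (-v)
  have hconst : ∀ x w : EuclideanSpace ℝ (Fin 3), lineDeriv ℝ (fun _ => (1 : ℝ)) x w = 0 :=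
    fun x w => by simp [lineDeriv]
  simp only [neg_neg, mul_one, hconst, zero_mul, integral_zero] at h1
  rw [← integral_indicator (isOpen_halfSpace σ).measurableSet, h1]
  refine integral_congr_ae ?_
  filter_upwards [ae_vertical_ne_zero] with p hp
  by_cases hpH : p ∈ halfSpace σ
  · have : (halfSpace σ).indicator g =ᶠ[𝓝 p] g := by
      filter_upwards [(isOpen_halfSpace σ).mem_nhds hpH] with q hq
      simp [hq]
    rw [this.lineDeriv_eq, indicator_of_mem hpH,
      (hg.differentiable one_ne_zero p).lineDeriv_eq_fderiv]
    rfl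
  · have hopen : IsOpen {q : EuclideanSpace ℝ (Fin 3) | σ * q 2 < 0} :=
      isOpen_lt (by fun_prop) continuous_const
    have hlt : σ * p 2 < 0 :=
      lt_of_le_of_ne (not_lt.1 hpH) (mul_ne_zero hσ hp)
    have : (halfSpace σ).indicator g =ᶠ[𝓝 p] fun _ => (0 : ℝ) := by
      filter_upwards [hopen.mem_nhds hlt] with q hq
      have hq' : q ∉ halfSpace σ := not_lt.2 (le_of_lt hq)
      exact indicator_of_notMem hq' g
    rw [this.lineDeriv_eq, indicator_of_notMem hpH]
    simp [lineDeriv]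

section WeakForm

variable {a b c A B C : EuclideanSpace ℝ (Fin 3) → ℝ} {lam : ℝ} {i j k : Fin 3}

/-- The curl is formally self-adjoint. Here `(a, b, c)` are the components, in the order `i, j, k`,
of a field with `curl = lam` times itself that vanishes on the plane, and `(A, B, C)` those of a
compactly supported test field. -/
theorem integral_halfSpace_curl_adjoint (ha : ContDiff ℝ 1 a) (hb : ContDiff ℝ 1 b)
    (hc : ContDiff ℝ 1 c) (a0 : ∀ p, p 2 = 0 → a p = 0) (b0 : ∀ p, p 2 = 0 → b p = 0)
    (c0 : ∀ p, p 2 = 0 → c p = 0)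
    (ea : ∀ p, dirDeriv (rdir j) c p - dirDeriv (rdir k) b p = lam * a p)
    (eb : ∀ p, dirDeriv (rdir k) a p - dirDeriv (rdir i) c p = lam * b p)
    (ec : ∀ p, dirDeriv (rdir i) b p - dirDeriv (rdir j) a p = lam * c p)
    (hA : ContDiff ℝ 1 A) (hB : ContDiff ℝ 1 B) (hC : ContDiff ℝ 1 C)
    (sA : HasCompactSupport A) (sB : HasCompactSupport B) (sC : HasCompactSupport C)
    {σ : ℝ} (hσ : σ ≠ 0) :
    ∫ p in halfSpace σ,
      (a p * (dirDeriv (rdir j) C p - dirDeriv (rdir k) B p - lam * A p)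
        + b p * (dirDeriv (rdir k) A p - dirDeriv (rdir i) C p - lam * B p)
        + c p * (dirDeriv (rdir i) B p - dirDeriv (rdir j) A p - lam * C p)) = 0 := by
  have Z : ∀ (l : Fin 3) {f g : EuclideanSpace ℝ (Fin 3) → ℝ}, ContDiff ℝ 1 f →
      (∀ p, p 2 = 0 → f p = 0) → ContDiff ℝ 1 g → HasCompactSupport g →
      IntegrableOn (dirDeriv (rdir l) fun p => f p * g p) (halfSpace σ) ∧
        ∫ p in halfSpace σ, dirDeriv (rdir l) (fun p => f p * g p) p = 0 := by
    intro l f g hf f0 hg sg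
    have hfg : ContDiff ℝ 1 fun p => f p * g p := hf.mul hg
    have sfg : HasCompactSupport fun p => f p * g p := sg.mul_left
    refine ⟨?_, integral_halfSpace_dirDeriv hfg sfg (fun p hp => by simp [f0 p hp]) σ hσ _⟩
    have h1 : Continuous (dirDeriv (rdir l) fun p => f p * g p) :=
      (contDiff_dirDeriv (m := 0) hfg (by norm_num) _).continuous
    exact (h1.integrable_of_hasCompactSupport (sfg.fderiv_apply ℝ _)).integrableOn
  obtain ⟨i1, z1⟩ := Z i hb b0 hC sC
  obtain ⟨i2, z2⟩ := Z i hc c0 hB sB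
  obtain ⟨i3, z3⟩ := Z j hc c0 hA sA
  obtain ⟨i4, z4⟩ := Z j ha a0 hC sC
  obtain ⟨i5, z5⟩ := Z k ha a0 hB sB
  obtain ⟨i6, z6⟩ := Z k hb b0 hA sA
  have dm : ∀ (l : Fin 3) {f g : EuclideanSpace ℝ (Fin 3) → ℝ}, ContDiff ℝ 1 f →
      ContDiff ℝ 1 g → ∀ p, dirDeriv (rdir l) (fun p => f p * g p) p =
        f p * dirDeriv (rdir l) g p + dirDeriv (rdir l) f p * g p :=
    fun l f g hf hg p => dirDeriv_mul (hf.differentiable one_ne_zero p)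
      (hg.differentiable one_ne_zero p) _
  have e1 := integral_sub i2 i1
  have e2 := integral_sub i4 i3
  have e3 := integral_sub i6 i5
  have e12 := integral_add (i2.sub i1) (i4.sub i3)
  have e123 := integral_add ((i2.sub i1).add (i4.sub i3)) (i6.sub i5)
  simp only [Pi.add_apply, Pi.sub_apply] at e12 e123
  rw [e12, e1, e2, e3, z1, z2, z3, z4, z5, z6] at e123
  simp only [sub_zero, add_zero] at e123
  rw [← e123]
  refine integral_congr_ae (Eventually.of_forall fun p => ?_)
  simp only [dm _ hb hC, dm _ hc hB, dm _ hc hA, dm _ ha hC, dm _ ha hB, dm _ hb hA]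
  linear_combination A p * ea p + B p * eb p + C p * ec p

/-- The component `a` of the truncated field is a distributional solution of the Helmholtz
equation. The test field is `curl (ψ e) + lam ψ e + lam⁻¹ ∇ ∂ₑψ`, for which
`curl - lam` gives `-(Δψ + lam² ψ) e`. -/
theorem integral_halfSpace_helmholtz (hlam : lam ≠ 0) (ha : ContDiff ℝ 1 a) (hb : ContDiff ℝ 1 b)
    (hc : ContDiff ℝ 1 c) (a0 : ∀ p, p 2 = 0 → a p = 0) (b0 : ∀ p, p 2 = 0 → b p = 0)
    (c0 : ∀ p, p 2 = 0 → c p = 0)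
    (ea : ∀ p, dirDeriv (rdir j) c p - dirDeriv (rdir k) b p = lam * a p)
    (eb : ∀ p, dirDeriv (rdir k) a p - dirDeriv (rdir i) c p = lam * b p)
    (ec : ∀ p, dirDeriv (rdir i) b p - dirDeriv (rdir j) a p = lam * c p)
    {ψ : EuclideanSpace ℝ (Fin 3) → ℝ} (hψ : ContDiff ℝ 3 ψ) (sψ : HasCompactSupport ψ)
    {σ : ℝ} (hσ : σ ≠ 0) :
    ∫ p in halfSpace σ, a p * (dirDeriv (rdir i) (dirDeriv (rdir i) ψ) p +
      dirDeriv (rdir j) (dirDeriv (rdir j) ψ) p + dirDeriv (rdir k) (dirDeriv (rdir k) ψ) p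
        + lam ^ 2 * ψ p) = 0 := by
  have q1 : ∀ l, ContDiff ℝ 2 (dirDeriv (rdir l) ψ) := fun l =>
    contDiff_dirDeriv hψ (by norm_num) _
  have q1' : ∀ l, ContDiff ℝ 1 (dirDeriv (rdir l) ψ) := fun l => (q1 l).of_le (by norm_num)
  have q2 : ∀ l m, ContDiff ℝ 1 (dirDeriv (rdir m) (dirDeriv (rdir l) ψ)) := fun l m =>
    contDiff_dirDeriv (q1 l) (by norm_num) _
  have s1 : ∀ l, HasCompactSupport (dirDeriv (rdir l) ψ) := fun l => sψ.fderiv_apply ℝ _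
  have s2 : ∀ l m, HasCompactSupport (dirDeriv (rdir m) (dirDeriv (rdir l) ψ)) := fun l m =>
    (s1 l).fderiv_apply ℝ _
  have d0 : Differentiable ℝ ψ := hψ.differentiable (by norm_num)
  have d1 : ∀ l, Differentiable ℝ (dirDeriv (rdir l) ψ) := fun l =>
    (q1 l).differentiable (by norm_num)
  have d2 : ∀ l m, Differentiable ℝ (dirDeriv (rdir m) (dirDeriv (rdir l) ψ)) := fun l m =>
    (q2 l m).differentiable (by norm_num)
  have main := integral_halfSpace_curl_adjoint ha hb hc a0 b0 c0 ea eb ec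
    (A := fun p => lam * ψ p + lam⁻¹ * dirDeriv (rdir i) (dirDeriv (rdir i) ψ) p)
    (B := fun p => dirDeriv (rdir k) ψ p + lam⁻¹ * dirDeriv (rdir j) (dirDeriv (rdir i) ψ) p)
    (C := fun p => -dirDeriv (rdir j) ψ p + lam⁻¹ * dirDeriv (rdir k) (dirDeriv (rdir i) ψ) p)
    ((contDiff_const.mul (hψ.of_le (by norm_num))).add (contDiff_const.mul (q2 i i)))
    ((q1' k).add (contDiff_const.mul (q2 i j)))
    ((q1' j).neg.add (contDiff_const.mul (q2 i k)))
    ((sψ.mul_left).add (s2 i i).mul_left) ((s1 k).add (s2 i j).mul_left)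
    ((s1 j).neg.add (s2 i k).mul_left) hσ
  have eA : ∀ l, dirDeriv (rdir l)
      (fun p => lam * ψ p + lam⁻¹ * dirDeriv (rdir i) (dirDeriv (rdir i) ψ) p) = fun p =>
      lam * dirDeriv (rdir l) ψ p +
        lam⁻¹ * dirDeriv (rdir l) (dirDeriv (rdir i) (dirDeriv (rdir i) ψ)) p := fun l => by
    rw [dirDeriv_add (d0.const_mul _) ((d2 i i).const_mul _), dirDeriv_const_mul d0,
      dirDeriv_const_mul (d2 i i)]
  have eB : ∀ l, dirDeriv (rdir l)
      (fun p => dirDeriv (rdir k) ψ p + lam⁻¹ * dirDeriv (rdir j) (dirDeriv (rdir i) ψ) p) =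
      fun p => dirDeriv (rdir l) (dirDeriv (rdir k) ψ) p +
        lam⁻¹ * dirDeriv (rdir l) (dirDeriv (rdir j) (dirDeriv (rdir i) ψ)) p := fun l => by
    rw [dirDeriv_add (d1 k) ((d2 i j).const_mul _), dirDeriv_const_mul (d2 i j)]
  have eC : ∀ l, dirDeriv (rdir l)
      (fun p => -dirDeriv (rdir j) ψ p + lam⁻¹ * dirDeriv (rdir k) (dirDeriv (rdir i) ψ) p) =
      fun p => -dirDeriv (rdir l) (dirDeriv (rdir j) ψ) p +
        lam⁻¹ * dirDeriv (rdir l) (dirDeriv (rdir k) (dirDeriv (rdir i) ψ)) p := fun l => by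
    rw [dirDeriv_add (d1 j).fun_neg ((d2 i k).const_mul _), dirDeriv_neg,
      dirDeriv_const_mul (d2 i k)]
  have cm : ∀ l m, dirDeriv (rdir l) (dirDeriv (rdir m) ψ) =
      dirDeriv (rdir m) (dirDeriv (rdir l) ψ) := fun l m =>
    dirDeriv_comm (hψ.of_le (by norm_num)) _ _
  have cm' : ∀ l m, dirDeriv (rdir l) (dirDeriv (rdir m) (dirDeriv (rdir i) ψ)) =
      dirDeriv (rdir m) (dirDeriv (rdir l) (dirDeriv (rdir i) ψ)) := fun l m =>
    dirDeriv_comm (q1 i) _ _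
  simp only [eA, eB, eC] at main
  rw [← neg_eq_zero, ← integral_neg, ← main]
  refine integral_congr_ae (Eventually.of_forall fun p => ?_)
  have x1 := congrFun (cm' k j) p
  have x2 := congrFun (cm' k i) p
  have x3 := congrFun (cm' j i) p
  have y1 := congrFun (cm k i) p
  have y2 := congrFun (cm j i) p
  simp only
  rw [x1, x2, x3, y1, y2]
  field_simp
  ring

end WeakForm

/-! ### Radial solutions of the Helmholtz equation -/

/-- A smooth profile on the line that vanishes near `+∞`. Evaluated at the square of the distance
to a point, it gives a radial test function on Euclidean space. -/
structure IsRadialProfile (φ : ℝ → ℝ) : Prop where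
  contDiff : ContDiff ℝ ∞ φ
  eventually_zero : ∃ R, ∀ s, R ≤ s → φ s = 0

theorem contDiff_intervalIntegral {k : ℝ → ℝ} (hk : ContDiff ℝ ∞ k) (a : ℝ) :
    ContDiff ℝ ∞ fun r => ∫ t in a..r, k t := by
  have hd : ∀ r, HasDerivAt (fun r => ∫ t in a..r, k t) (k r) r := fun r =>
    hk.continuous.integral_hasStrictDerivAt a r |>.hasDerivAt
  rw [contDiff_infty_iff_deriv]
  refine ⟨fun r => (hd r).differentiableAt, ?_⟩
  rwa [show deriv (fun r => ∫ t in a..r, k t) = k from funext fun r => (hd r).deriv]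

theorem intervalIntegral_eq_zero_of_zero_above {k : ℝ → ℝ} {a r : ℝ}
    (hk : ∀ t, a ≤ t → k t = 0) (hr : a ≤ r) : ∫ t in a..r, k t = 0 := by
  refine intervalIntegral.integral_zero_ae (Eventually.of_forall fun t ht => hk t ?_)
  rw [uIoc_of_le hr] at ht
  exact ht.1.le

theorem IsRadialProfile.exists_antideriv {φ : ℝ → ℝ} (hφ : IsRadialProfile φ) :
    ∃ Φ, IsRadialProfile Φ ∧ ∀ s, HasDerivAt Φ (φ s) s := by
  obtain ⟨R, hR⟩ := hφ.eventually_zero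
  exact ⟨fun r => ∫ t in R..r, φ t, ⟨contDiff_intervalIntegral hφ.contDiff R,
    R, fun s hs => intervalIntegral_eq_zero_of_zero_above hR hs⟩, fun s =>
    (hφ.contDiff.continuous.integral_hasStrictDerivAt R s).hasDerivAt⟩

/-- Variation of constants: `h'' + lam² h = k` has a solution vanishing where `k` vanishes near
`+∞`. -/
theorem exists_oscillator_solution {lam : ℝ} (hlam : lam ≠ 0) {k : ℝ → ℝ} (hk : ContDiff ℝ ∞ k)
    {a : ℝ} (ha : ∀ t, a ≤ t → k t = 0) :
    ∃ h h₁ : ℝ → ℝ, ContDiff ℝ ∞ h ∧ (∀ r, a ≤ r → h r = 0) ∧ (∀ r, HasDerivAt h (h₁ r) r) ∧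
      ∀ r, HasDerivAt h₁ (k r - lam ^ 2 * h r) r := by
  have hkc : ContDiff ℝ ∞ fun t => Real.cos (lam * t) * k t :=
    (Real.contDiff_cos.comp (contDiff_const.mul contDiff_id)).mul hk
  have hks : ContDiff ℝ ∞ fun t => Real.sin (lam * t) * k t :=
    (Real.contDiff_sin.comp (contDiff_const.mul contDiff_id)).mul hk
  set C : ℝ → ℝ := fun r => ∫ t in a..r, Real.cos (lam * t) * k t with hC
  set S : ℝ → ℝ := fun r => ∫ t in a..r, Real.sin (lam * t) * k t with hS
  have dC : ∀ r, HasDerivAt C (Real.cos (lam * r) * k r) r := fun r =>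
    (hkc.continuous.integral_hasStrictDerivAt a r).hasDerivAt
  have dS : ∀ r, HasDerivAt S (Real.sin (lam * r) * k r) r := fun r =>
    (hks.continuous.integral_hasStrictDerivAt a r).hasDerivAt
  have dl : ∀ r : ℝ, HasDerivAt (fun r => lam * r) lam r := fun r => by
    simpa using (hasDerivAt_id r).const_mul lam
  have dc : ∀ r, HasDerivAt (fun r => Real.cos (lam * r)) (-Real.sin (lam * r) * lam) r :=
    fun r => (dl r).cos
  have ds : ∀ r, HasDerivAt (fun r => Real.sin (lam * r)) (Real.cos (lam * r) * lam) r :=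
    fun r => (dl r).sin
  refine ⟨fun r => (Real.sin (lam * r) * C r - Real.cos (lam * r) * S r) / lam,
    fun r => Real.cos (lam * r) * C r + Real.sin (lam * r) * S r, ?_, ?_, ?_, ?_⟩
  · exact (((Real.contDiff_sin.comp (contDiff_const.mul contDiff_id)).mul
      (contDiff_intervalIntegral hkc a)).sub ((Real.contDiff_cos.comp
        (contDiff_const.mul contDiff_id)).mul (contDiff_intervalIntegral hks a))).div_const lam
  · intro r hr
    have h1 : C r = 0 := intervalIntegral_eq_zero_of_zero_above (fun t ht => by simp [ha t ht]) hr
    have h2 : S r = 0 := intervalIntegral_eq_zero_of_zero_above (fun t ht => by simp [ha t ht]) hr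
    simp [h1, h2]
  · intro r
    refine ((((ds r).mul (dC r)).sub ((dc r).mul (dS r))).div_const lam).congr_deriv ?_
    field_simp
    ring
  · intro r
    refine (((dc r).mul (dC r)).add ((ds r).mul (dS r))).congr_deriv ?_
    field_simp
    linear_combination k r * Real.sin_sq_add_cos_sq (lam * r)

/-- The Helmholtz equation for radial functions on `ℝ³`, in the variable `s = r²`: away from the
origin it has compactly supported solutions for every compactly supported right-hand side. -/
theorem exists_radial_solution {lam : ℝ} (hlam : lam ≠ 0) {φ : ℝ → ℝ} (hφ : IsRadialProfile φ)
    {δ : ℝ} (hδ : 0 < δ) :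
    ∃ χ χ₁ χ₂ : ℝ → ℝ, ContDiff ℝ ∞ χ ∧ (∃ R, ∀ s, R ≤ s → χ s = 0) ∧
      (∀ s, HasDerivAt χ (χ₁ s) s) ∧ (∀ s, HasDerivAt χ₁ (χ₂ s) s) ∧
      ∀ s, δ ≤ s → 4 * s * χ₂ s + 6 * χ₁ s + lam ^ 2 * χ s = φ s := by
  obtain ⟨R, hR⟩ := hφ.eventually_zero
  have hk : ContDiff ℝ ∞ fun t : ℝ => t * φ (t ^ 2) :=
    contDiff_id.mul (hφ.contDiff.comp (contDiff_id.pow 2))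
  have hk0 : ∀ t, √R ≤ t → t * φ (t ^ 2) = 0 := fun t ht => by
    rw [hR _ (Real.sqrt_le_left ((Real.sqrt_nonneg R).trans ht) |>.1 ht), mul_zero]
  obtain ⟨h, h₁, hh, h0, dh, dh₁⟩ := exists_oscillator_solution hlam hk hk0
  -- `h (√s) / √s` solves the equation for `s > 0`; the cutoff `θ` removes the singularity at `0`.
  set θ : ℝ → ℝ := fun s => Real.smoothTransition (3 * s / δ - 1) with hθ
  have hθs : ContDiff ℝ ∞ θ :=
    Real.smoothTransition.contDiff.comp
      (((contDiff_const.mul contDiff_id).div_const δ).sub contDiff_const)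
  have hχ : ContDiff ℝ ∞ fun s => θ s * (h (√s) / √s) := by
    rw [contDiff_iff_contDiffAt]
    intro s
    rcases lt_or_ge s (δ / 3) with hs | hs
    · have : (fun s => θ s * (h (√s) / √s)) =ᶠ[𝓝 s] fun _ => 0 := by
        filter_upwards [Iio_mem_nhds hs] with r hr
        have : 3 * r / δ - 1 ≤ 0 := by
          rw [sub_nonpos, div_le_one hδ]
          linarith [mem_Iio.1 hr]
        simp [hθ, Real.smoothTransition.zero_of_nonpos this]
      exact contDiffAt_const.congr_of_eventuallyEq this
    · have hs0 : 0 < s := by linarith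
      have hsq : ContDiffAt ℝ ∞ Real.sqrt s := Real.contDiffAt_sqrt hs0.ne'
      exact hθs.contDiffAt.mul ((hh.contDiffAt.comp s hsq).div hsq (Real.sqrt_pos.2 hs0).ne')
  have hχ1 := (contDiff_infty_iff_deriv.1 hχ)
  have hχ2 := (contDiff_infty_iff_deriv.1 hχ1.2)
  refine ⟨_, _, _, hχ, ⟨max R 0, fun s hs => ?_⟩, fun s => (hχ1.1 s).hasDerivAt,
    fun s => (hχ2.1 s).hasDerivAt, fun s hs => ?_⟩
  · simp [h0 _ (Real.sqrt_le_sqrt ((le_max_left _ _).trans hs))]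
  · have hev : ∀ r, 2 * δ / 3 < r → (fun s => θ s * (h (√s) / √s)) =ᶠ[𝓝 r]
        fun s => h (√s) / √s := by
      intro r hr
      filter_upwards [Ioi_mem_nhds hr] with q hq
      have : 1 ≤ 3 * q / δ - 1 := by
        rw [le_sub_iff_add_le, le_div_iff₀ hδ]
        linarith [mem_Ioi.1 hq]
      simp [hθ, Real.smoothTransition.one_of_one_le this]
    have e1 : ∀ r, 2 * δ / 3 < r → deriv (fun s => θ s * (h (√s) / √s)) r =
        (h₁ (√r) / r - h (√r) / (r * √r)) / 2 := by
      intro r hr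
      have hr0 : 0 < r := by linarith
      have hq := Real.sqrt_pos.2 hr0
      have hd := Real.hasDerivAt_sqrt hr0.ne'
      have := Real.sq_sqrt hr0.le
      refine (hev r hr).deriv_eq.trans
        ((((dh (√r)).comp r hd).div hd hq.ne').congr_deriv ?_).deriv
      simp only [Function.comp_apply]
      field_simp
      rw [this]
      field_simp
    have hs' : 2 * δ / 3 < s := by linarith
    have hs0 : 0 < s := by linarith
    have hq := Real.sqrt_pos.2 hs0
    have e2 : deriv (deriv fun s => θ s * (h (√s) / √s)) s =
        ((√s * φ (√s ^ 2) - lam ^ 2 * h (√s)) / (2 * √s) / s - h₁ (√s) / s ^ 2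
          - (h₁ (√s) / (2 * √s) / (s * √s)
            - h (√s) * (√s + s / (2 * √s)) / (s * √s) ^ 2)) / 2 := by
      have : deriv (fun s => θ s * (h (√s) / √s)) =ᶠ[𝓝 s]
          fun r => (h₁ (√r) / r - h (√r) / (r * √r)) / 2 := by
        filter_upwards [Ioi_mem_nhds hs'] with r hr
        exact e1 r hr
      have hd := Real.hasDerivAt_sqrt hs0.ne'
      rw [this.deriv_eq]
      refine HasDerivAt.deriv ?_
      refine ((((dh₁ (√s)).comp s hd).div (hasDerivAt_id s) hs0.ne').sub
        (((dh (√s)).comp s hd).div ((hasDerivAt_id s).mul hd) (mul_pos hs0 hq).ne')).div_const 2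
        |>.congr_deriv ?_
      simp only [Function.comp_apply, id, Pi.mul_apply]
      field_simp
    rw [e2, e1 s hs', (hev s hs').eq_of_nhds, Real.sq_sqrt hs0.le]
    have hsq := Real.sq_sqrt hs0.le
    set q := √s with hqdef
    rw [← hsq]
    field_simp
    ring

section Radial

theorem hasFDerivAt_norm_sub_sq (x p : EuclideanSpace ℝ (Fin 3)) :
    HasFDerivAt (fun q => ‖q - x‖ ^ 2) ((2 : ℝ) • innerSL ℝ (p - x)) p := by
  have h := (hasStrictFDerivAt_norm_sq (p - x)).hasFDerivAt.comp p ((hasFDerivAt_id p).sub_const x)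
  refine h.congr_fderiv ?_
  ext v
  simp

theorem hasFDerivAt_radial {χ χ₁ : ℝ → ℝ} (h : ∀ s, HasDerivAt χ (χ₁ s) s)
    (x p : EuclideanSpace ℝ (Fin 3)) :
    HasFDerivAt (fun q => χ (‖q - x‖ ^ 2))
      (χ₁ (‖p - x‖ ^ 2) • (2 : ℝ) • innerSL ℝ (p - x)) p :=
  (h _).comp_hasFDerivAt p (hasFDerivAt_norm_sub_sq x p)

theorem dirDeriv_radial {χ χ₁ : ℝ → ℝ} (h : ∀ s, HasDerivAt χ (χ₁ s) s)
    (x : EuclideanSpace ℝ (Fin 3)) (i : Fin 3) :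
    dirDeriv (rdir i) (fun p => χ (‖p - x‖ ^ 2)) =
      fun p => χ₁ (‖p - x‖ ^ 2) * (2 * (p i - x i)) := by
  funext p
  rw [dirDeriv_eq (hasFDerivAt_radial h x p)]
  simp [EuclideanSpace.inner_single_right]

theorem dirDeriv_twice_radial {χ χ₁ χ₂ : ℝ → ℝ} (h : ∀ s, HasDerivAt χ (χ₁ s) s)
    (h₁ : ∀ s, HasDerivAt χ₁ (χ₂ s) s) (x : EuclideanSpace ℝ (Fin 3)) (i : Fin 3)
    (p : EuclideanSpace ℝ (Fin 3)) :
    dirDeriv (rdir i) (dirDeriv (rdir i) (fun p => χ (‖p - x‖ ^ 2))) p =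
      4 * χ₂ (‖p - x‖ ^ 2) * (p i - x i) ^ 2 + 2 * χ₁ (‖p - x‖ ^ 2) := by
  rw [dirDeriv_radial h]
  have hl : HasFDerivAt (fun q : EuclideanSpace ℝ (Fin 3) => 2 * (q i - x i))
      ((2 : ℝ) • (EuclideanSpace.proj i : EuclideanSpace ℝ (Fin 3) →L[ℝ] ℝ)) p :=
    ((EuclideanSpace.proj i : EuclideanSpace ℝ (Fin 3) →L[ℝ] ℝ).hasFDerivAt.sub_const
      (x i)).const_mul 2
  rw [dirDeriv_mul (hasFDerivAt_radial h₁ x p).differentiableAt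
    hl.differentiableAt, dirDeriv_radial h₁, dirDeriv_eq hl]
  simp
  ring

theorem hasCompactSupport_radial {χ : ℝ → ℝ} {R : ℝ} (hR : ∀ s, R ≤ s → χ s = 0)
    (x : EuclideanSpace ℝ (Fin 3)) : HasCompactSupport fun p => χ (‖p - x‖ ^ 2) := by
  refine HasCompactSupport.intro (isCompact_closedBall x (√R)) fun p hp => hR _ ?_
  rw [mem_closedBall_iff_norm, not_le] at hp
  exact (Real.lt_sq_of_sqrt_lt hp).le

theorem contDiff_radial {χ : ℝ → ℝ} (h : ContDiff ℝ ∞ χ) (x : EuclideanSpace ℝ (Fin 3)) :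
    ContDiff ℝ ∞ fun p : EuclideanSpace ℝ (Fin 3) => χ (‖p - x‖ ^ 2) :=
  h.comp ((contDiff_norm_sq ℝ).comp (contDiff_id.sub contDiff_const))

end Radial

/-! ### Unique continuation -/

/-- All integrals of `g` against radial test functions centred at points of `U` vanish. This says
that the means of `g` over all spheres centred in `U` are zero. -/
def RadialMomentsVanish (U : Set (EuclideanSpace ℝ (Fin 3)))
    (g : EuclideanSpace ℝ (Fin 3) → ℝ) : Prop :=
  ∀ φ, IsRadialProfile φ → ∀ x ∈ U, ∫ p, g p * φ (‖p - x‖ ^ 2) = 0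

theorem integrable_mul_radial {g : EuclideanSpace ℝ (Fin 3) → ℝ} (hg : Continuous g) {φ : ℝ → ℝ}
    (hφ : IsRadialProfile φ) (x : EuclideanSpace ℝ (Fin 3)) :
    Integrable fun p => g p * φ (‖p - x‖ ^ 2) := by
  obtain ⟨R, hR⟩ := hφ.eventually_zero
  exact (hg.mul (contDiff_radial hφ.contDiff x).continuous).integrable_of_hasCompactSupport
    (hasCompactSupport_radial hR x).mul_left

/-- The algebra of polynomial functions on `ℝ³`. -/
noncomputable def coordinatePolynomials : Subalgebra ℝ C(EuclideanSpace ℝ (Fin 3), ℝ) :=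
  Algebra.adjoin ℝ (range fun i : Fin 3 => ⟨fun p => p i, by fun_prop⟩)

namespace RadialMomentsVanish

variable {U : Set (EuclideanSpace ℝ (Fin 3))} {f g : EuclideanSpace ℝ (Fin 3) → ℝ}

theorem add (hf : Continuous f) (hg : Continuous g) (h : RadialMomentsVanish U f)
    (h' : RadialMomentsVanish U g) : RadialMomentsVanish U fun p => f p + g p := by
  intro φ hφ x hx
  simp only [add_mul]
  rw [integral_add (integrable_mul_radial hf hφ x) (integrable_mul_radial hg hφ x), h φ hφ x hx,
    h' φ hφ x hx, add_zero]

theorem const_mul (h : RadialMomentsVanish U f) (c : ℝ) :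
    RadialMomentsVanish U fun p => c * f p := by
  intro φ hφ x hx
  simp only [mul_assoc]
  rw [integral_const_mul, h φ hφ x hx, mul_zero]

/-- Differentiating a vanishing radial integral in its centre produces a factor that is linear in
the coordinates. -/
theorem coord_mul (hU : IsOpen U) (hg : Continuous g) (h : RadialMomentsVanish U g) (i : Fin 3) :
    RadialMomentsVanish U fun p => p i * g p := by
  intro φ hφ x hx
  obtain ⟨Φ, hΦ, dΦ⟩ := hφ.exists_antideriv
  obtain ⟨R, hR⟩ := hΦ.eventually_zero
  set κ : EuclideanSpace ℝ (Fin 3) → ℝ := fun z => Φ (‖z - 0‖ ^ 2) with hκ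
  have cκ : ContDiff ℝ ∞ κ := contDiff_radial hΦ.contDiff 0
  have sκ : HasCompactSupport κ := hasCompactSupport_radial hR 0
  have hloc := hg.locallyIntegrable (μ := volume)
  have hd := sκ.hasFDerivAt_convolution_right (ContinuousLinearMap.mul ℝ ℝ) hloc
    (cκ.of_le (by norm_num)) x
  have hzero : (g ⋆[ContinuousLinearMap.mul ℝ ℝ] κ) =ᶠ[𝓝 x] fun _ => 0 := by
    filter_upwards [hU.mem_nhds hx] with y hy
    rw [convolution_def]
    simp only [ContinuousLinearMap.mul_apply', hκ, sub_zero]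
    simpa [norm_sub_rev] using h Φ hΦ y hy
  have hder := (hd.congr_of_eventuallyEq hzero.symm).unique (hasFDerivAt_const (0 : ℝ) x)
  have happ := congrArg (fun T => T (rdir i)) hder
  have c1 : Continuous (fderiv ℝ κ) := cκ.continuous_fderiv (by norm_num)
  simp only [zero_apply] at happ
  rw [convolution_precompR_apply _ hloc (sκ.fderiv ℝ) c1, convolution_def] at happ
  have e : ∀ z, fderiv ℝ κ z (rdir i) = φ (‖z‖ ^ 2) * (2 * z i) := by
    intro z
    have := congrFun (dirDeriv_radial dΦ 0 i) z
    simpa [dirDeriv, hκ] using this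
  simp only [ContinuousLinearMap.mul_apply', e] at happ
  have hpg : Continuous fun p : EuclideanSpace ℝ (Fin 3) => p i * g p := by fun_prop
  have i1 := (integrable_mul_radial hg hφ x).const_mul (2 * x i)
  have i2 := (integrable_mul_radial hpg hφ x).const_mul 2
  have hsplit := integral_sub i1 i2
  rw [integral_const_mul, integral_const_mul, h φ hφ x hx] at hsplit
  have hcongr : ∫ p, g p * (φ (‖x - p‖ ^ 2) * (2 * (x - p) i)) =
      ∫ p, (2 * x i * (g p * φ (‖p - x‖ ^ 2)) - 2 * (p i * g p * φ (‖p - x‖ ^ 2))) := by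
    refine integral_congr_ae (Eventually.of_forall fun p => ?_)
    simp only [norm_sub_rev x p, PiLp.sub_apply]
    ring
  rw [hcongr, hsplit] at happ
  linarith

theorem polynomial_mul (hU : IsOpen U) {P : C(EuclideanSpace ℝ (Fin 3), ℝ)}
    (hP : P ∈ coordinatePolynomials) : ∀ g : EuclideanSpace ℝ (Fin 3) → ℝ, Continuous g →
      RadialMomentsVanish U g → RadialMomentsVanish U fun p => P p * g p := by
  induction hP using Algebra.adjoin_induction with
  | mem P hP =>
    obtain ⟨i, rfl⟩ := hP
    exact fun g hg h => h.coord_mul hU hg i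
  | algebraMap c => exact fun g _ h => h.const_mul c
  | add P Q _ _ hP hQ =>
    intro g hg h
    have := (hP g hg h).add (by fun_prop) (by fun_prop) (hQ g hg h)
    simpa [add_mul] using this
  | mul P Q _ _ hP hQ =>
    intro g hg h
    have := hP _ (by fun_prop) (hQ g hg h)
    simpa [mul_assoc] using this

/-- A continuous function whose means vanish over all spheres centred in a nonempty open set is
zero: it is orthogonal to all polynomials on balls, which are dense by Stone–Weierstrass. -/
theorem eq_zero (hU : IsOpen U) (hf : Continuous f) (h : RadialMomentsVanish U f)
    {x : EuclideanSpace ℝ (Fin 3)} (hx : x ∈ U) : f = 0 := by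
  funext y
  set R : ℝ := ‖y - x‖ ^ 2 + 1 with hR
  set φ : ℝ → ℝ := fun s => Real.smoothTransition (R - s) with hφdef
  have hφ0 : ∀ s, R ≤ s → φ s = 0 := fun s hs =>
    Real.smoothTransition.zero_of_nonpos (by linarith)
  have hφ : IsRadialProfile φ :=
    ⟨Real.smoothTransition.contDiff.comp (contDiff_const.sub contDiff_id), R, hφ0⟩
  set w : EuclideanSpace ℝ (Fin 3) → ℝ := fun p => φ (‖p - x‖ ^ 2) with hw
  have hwc : Continuous w := (contDiff_radial hφ.contDiff x).continuous
  have hws : HasCompactSupport w := hasCompactSupport_radial hφ0 x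
  have hw0 : ∀ p, 0 ≤ w p := fun p => Real.smoothTransition.nonneg _
  have hsep : coordinatePolynomials.SeparatesPoints := by
    intro p q hpq
    obtain ⟨i, hi⟩ : ∃ i, p i ≠ q i := by
      by_contra! hcon
      exact hpq (PiLp.ext hcon)
    exact ⟨_, ⟨_, Algebra.subset_adjoin ⟨i, rfl⟩, rfl⟩, hi⟩
  set I : ℝ := ∫ p, |f p| * w p with hI
  have hI0 : 0 ≤ I := integral_nonneg fun p => mul_nonneg (abs_nonneg _) (hw0 p)
  have hint : Integrable fun p => |f p| * w p := integrable_mul_radial hf.abs hφ x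
  have hsmall : ∀ ε > 0, ∫ p, f p * f p * w p ≤ ε * I := by
    intro ε hε
    obtain ⟨P, hP, hPf⟩ :=
      ContinuousMap.exists_mem_subalgebra_near_continuous_of_isCompact_of_separatesPoints hsep
        ⟨f, hf⟩ hws hε
    have hz : ∫ p, P p * f p * w p = 0 := polynomial_mul hU hP f hf h φ hφ x hx
    have j1 : Integrable fun p => f p * f p * w p := integrable_mul_radial (hf.mul hf) hφ x
    have j2 : Integrable fun p => P p * f p * w p :=
      integrable_mul_radial (by fun_prop) hφ x
    rw [← sub_zero (∫ p, f p * f p * w p), ← hz, ← integral_sub j1 j2, hI, ← integral_const_mul]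
    refine integral_mono (j1.sub j2) (hint.const_mul ε) fun p => ?_
    by_cases hp : p ∈ tsupport w
    · have h1 : |f p - P p| ≤ ε := by
        rw [abs_sub_comm]
        exact (hPf p hp).le
      calc f p * f p * w p - P p * f p * w p = (f p - P p) * f p * w p := by ring
        _ ≤ |(f p - P p) * f p| * w p := by gcongr; exacts [hw0 p, le_abs_self _]
        _ = |f p - P p| * (|f p| * w p) := by rw [abs_mul, mul_assoc]
        _ ≤ ε * (|f p| * w p) := by
          gcongr
          exact mul_nonneg (abs_nonneg _) (hw0 p)
    · simp [image_eq_zero_of_notMem_tsupport hp]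
  have hle : ∫ p, f p * f p * w p ≤ 0 := by
    refine le_of_forall_pos_le_add fun ε hε => ?_
    have := hsmall (ε / (I + 1)) (by positivity)
    calc _ ≤ ε / (I + 1) * I := this
      _ ≤ 0 + ε := by
        rw [zero_add, div_mul_eq_mul_div, div_le_iff₀ (by positivity)]
        nlinarith
  by_contra hy
  have hwy : 0 < w y := Real.smoothTransition.pos_of_pos (by rw [hR]; linarith)
  have hpos := Continuous.integral_pos_of_hasCompactSupport_nonneg_nonzero (μ := volume)
    (f := fun p => f p * f p * w p) (x := y) (by fun_prop) hws.mul_left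
    (fun p => mul_nonneg (mul_self_nonneg _) (hw0 p))
    (mul_ne_zero (mul_ne_zero hy hy) hwy.ne')
  linarith

end RadialMomentsVanish

/-- Unique continuation: a continuous distributional solution of `Δf + lam² f = 0` on `ℝ³` that
vanishes on a nonempty open set is zero. -/
theorem eq_zero_of_helmholtz_of_eq_zero_on_open {lam : ℝ} (hlam : lam ≠ 0)
    {f : EuclideanSpace ℝ (Fin 3) → ℝ} (hf : Continuous f)
    (hweak : ∀ ψ : EuclideanSpace ℝ (Fin 3) → ℝ, ContDiff ℝ 3 ψ → HasCompactSupport ψ →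
      ∫ p, f p * (dirDeriv (rdir 0) (dirDeriv (rdir 0) ψ) p +
        dirDeriv (rdir 1) (dirDeriv (rdir 1) ψ) p + dirDeriv (rdir 2) (dirDeriv (rdir 2) ψ) p
          + lam ^ 2 * ψ p) = 0)
    {U : Set (EuclideanSpace ℝ (Fin 3))} (hU : IsOpen U) (hfU : ∀ p ∈ U, f p = 0)
    {x₀ : EuclideanSpace ℝ (Fin 3)} (hx₀ : x₀ ∈ U) : f = 0 := by
  refine RadialMomentsVanish.eq_zero hU hf (fun φ hφ x hx => ?_) hx₀
  obtain ⟨ρ, hρ, hball⟩ := Metric.isOpen_iff.1 hU x hx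
  obtain ⟨χ, χ₁, χ₂, hχ, ⟨R, hR⟩, d₁, d₂, hode⟩ :=
    exists_radial_solution hlam hφ (pow_pos hρ 2)
  rw [← hweak (fun p => χ (‖p - x‖ ^ 2)) (contDiff_infty.1 (contDiff_radial hχ x) 3)
    (hasCompactSupport_radial hR x)]
  refine integral_congr_ae (Eventually.of_forall fun p => ?_)
  simp only [dirDeriv_twice_radial d₁ d₂]
  rcases lt_or_ge ‖p - x‖ ρ with hp | hp
  · simp [hfU p (hball (mem_ball_iff_norm.2 hp))]
  · congr 1
    rw [← hode (‖p - x‖ ^ 2) (by gcongr)]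
    have hn : ‖p - x‖ ^ 2 = (p 0 - x 0) ^ 2 + (p 1 - x 1) ^ 2 + (p 2 - x 2) ^ 2 := by
      rw [EuclideanSpace.norm_sq_eq, Fin.sum_univ_three]
      simp
    linear_combination 4 * χ₂ (‖p - x‖ ^ 2) * hn

/-! ### The Cauchy problem for Beltrami fields -/

/-- A Beltrami field that vanishes on the plane `{p | p 2 = 0}` is zero. -/
theorem beltramiField_eq_zero_of_eq_zero_on_plane {lam : ℝ} (hlam : lam ≠ 0)
    {v : EuclideanSpace ℝ (Fin 3) → EuclideanSpace ℝ (Fin 3)} (hv : ContDiff ℝ 1 v)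
    (hcurl : ∀ p, curl v p = lam • v p) (h0 : ∀ p, p 2 = 0 → v p = 0) : v = 0 := by
  have hvd := hv.differentiable one_ne_zero
  have cv : ∀ i, ContDiff ℝ 1 fun p => v p i := fun i => contDiff_euclidean.1 hv i
  have v0 : ∀ i p, p 2 = 0 → v p i = 0 := fun i p hp => by simp [h0 p hp]
  have c0 : ∀ p, dirDeriv (rdir 1) (fun q => v q 2) p - dirDeriv (rdir 2) (fun q => v q 1) p =
      lam * v p 0 := fun p => by
    have := congrArg (fun z : EuclideanSpace ℝ (Fin 3) => z 0) (hcurl p)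
    simpa [curl, pderivComp_eq_dirDeriv hvd] using this
  have c1 : ∀ p, dirDeriv (rdir 2) (fun q => v q 0) p - dirDeriv (rdir 0) (fun q => v q 2) p =
      lam * v p 1 := fun p => by
    have := congrArg (fun z : EuclideanSpace ℝ (Fin 3) => z 1) (hcurl p)
    simpa [curl, pderivComp_eq_dirDeriv hvd] using this
  have c2 : ∀ p, dirDeriv (rdir 0) (fun q => v q 1) p - dirDeriv (rdir 1) (fun q => v q 0) p =
      lam * v p 2 := fun p => by
    have := congrArg (fun z : EuclideanSpace ℝ (Fin 3) => z 2) (hcurl p)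
    simpa [curl, pderivComp_eq_dirDeriv hvd] using this
  have weak : ∀ (σ : ℝ), σ ≠ 0 → ∀ (j : Fin 3) (ψ : EuclideanSpace ℝ (Fin 3) → ℝ),
      ContDiff ℝ 3 ψ → HasCompactSupport ψ → ∫ p in halfSpace σ, v p j *
        (dirDeriv (rdir 0) (dirDeriv (rdir 0) ψ) p + dirDeriv (rdir 1) (dirDeriv (rdir 1) ψ) p
          + dirDeriv (rdir 2) (dirDeriv (rdir 2) ψ) p + lam ^ 2 * ψ p) = 0 := by
    intro σ hσ j ψ hψ sψ
    fin_cases j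
    · exact integral_halfSpace_helmholtz hlam (cv 0) (cv 1) (cv 2) (v0 0) (v0 1) (v0 2) c0 c1 c2
        hψ sψ hσ
    · rw [← integral_halfSpace_helmholtz hlam (cv 1) (cv 2) (cv 0) (v0 1) (v0 2) (v0 0) c1 c2 c0
        hψ sψ hσ]
      refine integral_congr_ae (Eventually.of_forall fun p => ?_)
      simp only [Fin.mk_one]
      ring
    · rw [← integral_halfSpace_helmholtz hlam (cv 2) (cv 0) (cv 1) (v0 2) (v0 0) (v0 1) c2 c0 c1
        hψ sψ hσ]
      refine integral_congr_ae (Eventually.of_forall fun p => ?_)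
      simp only [Fin.reduceFinMk]
      ring
  -- The component, extended by zero from a half space, vanishes on the opposite half space.
  have trunc : ∀ (σ : ℝ), σ ≠ 0 → ∀ j, (halfSpace σ).indicator (fun p => v p j) = 0 := by
    intro σ hσ j
    have hfr : ∀ p ∈ frontier (halfSpace σ), v p j = 0 := by
      intro p hp
      have h1 := frontier_lt_subset_eq (continuous_const (y := (0 : ℝ)))
        (by fun_prop : Continuous fun p : EuclideanSpace ℝ (Fin 3) => σ * p 2) hp
      refine v0 j p ?_
      have h2 : 0 = σ * p 2 := h1
      simpa [hσ] using h2.symm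
    have hc : Continuous ((halfSpace σ).indicator fun p => v p j) :=
      continuous_indicator hfr (cv j).continuous.continuousOn
    refine eq_zero_of_helmholtz_of_eq_zero_on_open hlam hc (fun ψ hψ sψ => ?_)
      (isOpen_halfSpace (-σ)) (fun p hp => ?_) (x₀ := EuclideanSpace.single 2 (-σ)) ?_
    · rw [← weak σ hσ j ψ hψ sψ, ← integral_indicator (isOpen_halfSpace σ).measurableSet]
      refine integral_congr_ae (Eventually.of_forall fun p => ?_)
      by_cases hp : p ∈ halfSpace σ <;> simp [hp]
    · refine indicator_of_notMem ?_ _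
      simp only [halfSpace, mem_ofPred_eq, not_lt] at hp ⊢
      linarith
    · have := mul_self_pos.2 hσ
      simpa [halfSpace] using this
  funext p
  ext j
  rcases lt_trichotomy (p 2) 0 with hp | hp | hp
  · have hmem : p ∈ halfSpace (-1) := by simpa [halfSpace] using hp
    simpa [hmem] using congrFun (trunc (-1) (by norm_num) j) p
  · simpa using v0 j p hp
  · have hmem : p ∈ halfSpace 1 := by simpa [halfSpace] using hp
    simpa [hmem] using congrFun (trunc 1 one_ne_zero j) p

theorem theorem3p1 (F : EuclideanSpace ℝ (Fin 2) → ℝ) (hF : IsEntire F)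
    (lam : ℝ) (hlam : lam ≠ 0) :
    ∃ u : EuclideanSpace ℝ (Fin 3) → EuclideanSpace ℝ (Fin 3),
      (IsBeltramiField lam u ∧ HasGradientDatum F u ∧ ∀ i : Fin 3, IsEntire (fun p => u p i)) ∧
      ∀ w : EuclideanSpace ℝ (Fin 3) → EuclideanSpace ℝ (Fin 3),
        IsBeltramiField lam w → HasGradientDatum F w → w = u := by
  obtain ⟨u, hu, hFu, hent⟩ := exists_entire_beltramiField hF hlam
  refine ⟨u, ⟨hu, hFu, hent⟩, fun w hw hFw => ?_⟩
  have hwd := hw.contDiff.differentiable one_ne_zero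
  have hud := hu.contDiff.differentiable one_ne_zero
  have hd : ∀ p, fderiv ℝ (fun q => w q - u q) p = fderiv ℝ w p - fderiv ℝ u p := fun p =>
    fderiv_fun_sub (hwd p) (hud p)
  have hcurl : ∀ p, curl (fun q => w q - u q) p = lam • (w p - u p) := by
    intro p
    rw [smul_sub, ← hw.curl_eq p, ← hu.curl_eq p]
    ext i
    fin_cases i <;> simp [curl, pderivComp, hd] <;> ring
  have h0 := beltramiField_eq_zero_of_eq_zero_on_plane hlam (hw.contDiff.sub hu.contDiff) hcurl
    fun p hp => ?_
  · funext p
    exact sub_eq_zero.1 (congrFun h0 p)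
  · have hp' : p = !₂[p 0, p 1, 0] := by
      ext i
      fin_cases i <;> simp [hp]
    rw [hp', hFw, hFu, sub_self]
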